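/- Let $q_{o1},\dots,q_{oN}\in\mathbb R^n$ ($N\ge 1$) and $d_{s1},\dots,d_{sN}>0$. Put $h_i(q)=|q_{oi}-q|-d_{si}$ for $q\in\mathbb R^n$, $\underline d_s=\min_i d_{si}$, $\overline d_s=\max_i d_{si}$, and $l_{oi}(q)=(q_{oi}-q)/|q_{oi}-q|$ for $q\ne q_{oi}$, where $|\cdot|$ is the Euclidean norm. A continuous, strictly increasing $\alpha:\mathbb R\to\mathbb R$ with $\alpha(0)=0$ is said to be of class $\mathcal K^e$. Let $d_a,d_b,d_h>0$ with $d_a<\underline d_s$, $d_h<\underline d_s$ be such that, for every $q\in\mathbb R^n$ with $h_i(q)\ge -d_h$ for all $i$, and all $j,k$: if $h_j(q)\le d_b/2$ and $h_k(q)\le d_b/2$, then $|q_{oj}-q_{ok}|\le d_a$. Let $d_r>0$ and $\bar v$ satisfy $$\sqrt2\,\underline d_s>d_a,\qquad \bar v>2d_r,\qquad \frac{2\underline d_s^2-d_a^2}{2(\overline d_s+d_b/2)^2}>1-\frac{(\bar v-2d_r)^2}{2(\bar v-d_r)^2}.$$ Put $$c^*=\frac{(2\overline d_s+d_b)^2-4\underline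 d_s^2+2d_a^2}{2(2\overline d_s+d_b)^2},\qquad \delta=\sqrt{c^*+\tfrac{d_r}{\bar v-d_r}}-\sqrt{c^*}.$$ Then there exist a Lipschitz, nonnegative, (weakly) decreasing function $\phi:[-1,1]\to\mathbb R$, a constant $c_0\in(0,1)$ and a Lipschitz function $\alpha_c\in\mathcal K^e$ with Lipschitz inverse $\alpha_c^{-1}:\mathbb R\to\mathbb R$ such that $$c_0>\sqrt{c^*}+\sqrt{c^*+\tfrac{d_r}{\bar v-d_r}},\tag{1}$$ $$c_0(\bar v-d_r)\ \ge\ c_0\alpha_c(d_b/2)-d_r\ >\ \frac{d_r-c_0\alpha_c(-d_h)}{\delta},\tag{2}$$ $$\phi(s)>\max_{p\in[0,d_h]}\ \max_{K\in\{c_0(\bar v-d_r),\,(d_r-c_0\alpha_c(-p))/\delta\}}\Big\{\alpha_c^{-1}\Big(\frac{-K(s-c_0)-K\delta+d_r}{c_0}\Big)+p\Big\}\quad (s\in[-1,c_0)),\tag{3}$$ $$\phi(s)=0\quad (s\in[c_0,1]).\tag{4}$$ Call a finite set $\mathcal L\subset\mathbb R^n$ of unit vectors a positive basis for $c_0$ if,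 for every unit vector $u\in\mathbb R^n$, the set $\{l\in\mathcal L: l^Tu\ge c_0\}$ has at least $n$ elements and $u$ is a linear combination with nonnegative coefficients of its elements. For such $\mathcal L$ and $q,v_c\in\mathbb R^n$ with $q\ne q_{oi}$ for all $i$, consider the quadratic program $$\min_{v\in\mathbb R^n}|v-v_c|^2\quad\text{s.t.}\quad l^Tv\le c_0\alpha_c(r(q,l))-d_r,\quad l^Tv\le c_0(\bar v-d_r)\qquad\text{for all } l\in\mathcal L,\tag{QP}$$ where $r(q,l)=\min_{i}\{|q_{oi}-q|-d_{si}+\phi(l_{oi}(q)^Tl)\}$. Moreover, for every choice of $\phi,c_0,\alpha_c$ as above satisfying (1)–(4), a positive basis for $c_0$ exists, and there is a constant $\Delta_h\in(0,d_h]$ such that for every positive basis $\mathcal L$ for $c_0$ the following holds. (a) For all $q$ with $h_i(q)\ge-\Delta_h$ for all $i$, and all $v_c\in\mathbb R^n$, (QP) has a unique solution $v^*=\varphi(q,v_c)$. (b) For all such $q,v_c$ and all $\tilde v\in\mathbb R^n$, with $\dot q=v^*+\tilde v$ and $\alpha_p(s)=\max\{\alpha_c(s),c_0\alpha_c(s)\}$,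 each $h_i$ is differentiable at $q$ and $$\frac{\partial h_i(q)}{\partial q}\dot q\ \ge\ -\alpha_p(h_i(q))+d_r-|\tilde v|,\quad i=1,\dots,N;\qquad\text{moreover}\quad |v^*|\le\bar v-d_r.$$ (c) There is a constant $L>0$ such that $|\varphi(q_1,v_{c1})-\varphi(q_2,v_{c2})|\le L(|q_1-q_2|+|v_{c1}-v_{c2}|)$ for all $q_1,q_2$ with $h_i(q_1),h_i(q_2)\ge-\Delta_h$ for all $i$, and all $v_{c1},v_{c2}\in\mathbb R^n$. -/

import Mathlib

noncomputable section

namespace ReshapedQP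

/-- `ℝⁿ` with its Euclidean norm. -/
abbrev Vec (n : ℕ) := EuclideanSpace ℝ (Fin n)

/-- The position constraint functions `h_i(q) = |q_{oi} - q| - d_{si}`. -/
def barrier {n N : ℕ} (qo : Fin N → Vec n) (ds : Fin N → ℝ) (i : Fin N) (q : Vec n) : ℝ :=
  ‖qo i - q‖ - ds i

/-- The smallest safety margin. -/
def dsMin {N : ℕ} [NeZero N] (ds : Fin N → ℝ) : ℝ :=
  Finset.univ.inf' Finset.univ_nonempty ds

/-- The largest safety margin. -/
def dsMax {N : ℕ} [NeZero N] (ds : Fin N → ℝ) : ℝ :=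
  Finset.univ.sup' Finset.univ_nonempty ds

/-- The distance assumption on the ball obstacles, with its constants `d_a`, `d_b`, `d_h`. -/
structure ObstacleDistance {n N : ℕ} [NeZero N] (qo : Fin N → Vec n) (ds : Fin N → ℝ)
    (da db dh : ℝ) : Prop where
  da_pos : 0 < da
  da_lt : da < dsMin ds
  db_pos : 0 < db
  dh_pos : 0 < dh
  dh_lt : dh < dsMin ds
  dist_le : ∀ q : Vec n, (∀ i, -dh ≤ barrier qo ds i q) →
    ∀ j k : Fin N, barrier qo ds j q ≤ db / 2 → barrier qo ds k q ≤ db / 2 →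
      ‖qo j - qo k‖ ≤ da

/-- The class `𝒦ᵉ`. -/
structure IsClassKe (α : ℝ → ℝ) : Prop where
  continuous : Continuous α
  strictMono : StrictMono α
  map_zero : α 0 = 0

/-- The unit vector `l_{oi}(q)` pointing from `q` to the `i`-th obstacle (used only at
`q ≠ q_{oi}`). -/
def obstacleDir {n N : ℕ} (qo : Fin N → Vec n) (i : Fin N) (q : Vec n) : Vec n :=
  (‖qo i - q‖)⁻¹ • (qo i - q)

/-- The distance-regularization function
`r(q, l) = min_i {|q_{oi} - q| - d_{si} + φ(l_{oi}(q)ᵀ l)}`. -/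
def regDist {n N : ℕ} [NeZero N] (qo : Fin N → Vec n) (ds : Fin N → ℝ) (φ : ℝ → ℝ)
    (q l : Vec n) : ℝ :=
  Finset.univ.inf' Finset.univ_nonempty
    fun i : Fin N => ‖qo i - q‖ - ds i + φ (inner ℝ (obstacleDir qo i q) l)

/-- The finite sets `𝓛 = {l_1, …, l_m}` of unit vectors used to reshape the feasible set: every
unit vector `u` is a positive combination (nonnegative coefficients, as usual for positive bases)
of those elements `l` of `𝓛` with `lᵀ u ≥ c₀`, and there are at least `n` such elements.
In particular `𝓛` positively spans `ℝⁿ`; minimality is not required. -/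
structure IsPositiveBasis {n : ℕ} (c0 : ℝ) (L : Finset (Vec n)) : Prop where
  norm_eq_one : ∀ l ∈ L, ‖l‖ = 1
  combination : ∀ u : Vec n, ‖u‖ = 1 → ∃ ρ : Vec n → ℝ, (∀ l, 0 ≤ ρ l) ∧
    u = ∑ l ∈ L with c0 ≤ inner ℝ l u, ρ l • l
  card_le : ∀ u : Vec n, ‖u‖ = 1 → n ≤ (L.filter fun l => c0 ≤ inner ℝ l u).card

/-- The feasible set of the reshaped QP at the position `q`. -/
def feasibleSet {n N : ℕ} [NeZero N] (qo : Fin N → Vec n) (ds : Fin N → ℝ) (dr vbar : ℝ)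
    (φ : ℝ → ℝ) (c0 : ℝ) (αc : ℝ → ℝ) (L : Finset (Vec n)) (q : Vec n) : Set (Vec n) :=
  {v | ∀ l ∈ L, inner ℝ l v ≤ c0 * αc (regDist qo ds φ q l) - dr ∧
    inner ℝ l v ≤ c0 * (vbar - dr)}

/-- `v` solves the reshaped QP: it minimizes `|v - v_c|²` over the feasible set. -/
def IsQPSolution {n N : ℕ} [NeZero N] (qo : Fin N → Vec n) (ds : Fin N → ℝ) (dr vbar : ℝ)
    (φ : ℝ → ℝ) (c0 : ℝ) (αc : ℝ → ℝ) (L : Finset (Vec n)) (q vc v : Vec n) : Prop :=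
  v ∈ feasibleSet qo ds dr vbar φ c0 αc L q ∧
    ∀ w ∈ feasibleSet qo ds dr vbar φ c0 αc L q, ‖v - vc‖ ^ 2 ≤ ‖w - vc‖ ^ 2

/-- The constant `c*`. -/
def cStar {N : ℕ} [NeZero N] (ds : Fin N → ℝ) (da db : ℝ) : ℝ :=
  ((2 * dsMax ds + db) ^ 2 - 4 * dsMin ds ^ 2 + 2 * da ^ 2) / (2 * (2 * dsMax ds + db) ^ 2)

/-- The quantity `√(c* + d_r / (v̄ - d_r)) - √c*`, here with `c = c*`. -/
def rootGap (c dr vbar : ℝ) : ℝ :=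
  √(c + dr / (vbar - dr)) - √c

/-- The requirements on the design data `φ`, `c₀`, `α_c`, with `c` in the role of `c*` and `αcInv`
the inverse function of `αc`. The function `φ` matters on `[-1, 1]` only. In `phi_gt` the maximum
over the compact set of pairs `(p, K)` is attained, so being larger than it means being larger than
every value. -/
structure DesignConditions (c db dh dr vbar : ℝ) (φ : ℝ → ℝ) (c0 : ℝ) (αc αcInv : ℝ → ℝ) :
    Prop where
  phi_lipschitz : ∃ K, LipschitzOnWith K φ (Set.Icc (-1) 1)
  phi_nonneg : ∀ s ∈ Set.Icc (-1 : ℝ) 1, 0 ≤ φ s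
  phi_antitone : AntitoneOn φ (Set.Icc (-1) 1)
  c0_pos : 0 < c0
  c0_lt_one : c0 < 1
  alpha_class : IsClassKe αc
  alpha_lipschitz : ∃ K, LipschitzWith K αc
  inv_left : Function.LeftInverse αcInv αc
  inv_right : Function.RightInverse αcInv αc
  inv_lipschitz : ∃ K, LipschitzWith K αcInv
  c0_gt : √c + √(c + dr / (vbar - dr)) < c0
  alpha_le : c0 * αc (db / 2) - dr ≤ c0 * (vbar - dr)
  alpha_gt : (dr - c0 * αc (-dh)) / rootGap c dr vbar < c0 * αc (db / 2) - dr
  phi_gt : ∀ s ∈ Set.Ico (-1 : ℝ) c0, ∀ p ∈ Set.Icc 0 dh,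
    ∀ K ∈ ({c0 * (vbar - dr), (dr - c0 * αc (-p)) / rootGap c dr vbar} : Set ℝ),
      αcInv (-K * (s - c0) / c0 + (-K * rootGap c dr vbar + dr) / c0) + p < φ s
  phi_eq_zero : ∀ s ∈ Set.Icc c0 1, φ s = 0

/-- The function `α_p(s) = max {α_c(s), c₀ α_c(s)}`. -/
def alphaP (c0 : ℝ) (αc : ℝ → ℝ) (s : ℝ) : ℝ :=
  max (αc s) (c0 * αc s)

end ReshapedQP

end

/-! Feasibility. For obstacles within `db / 2`, the squared distance between two of the directions
`obstacleDir` is at most `4 * cStar` in the limit of zero constraint violation. Since `c0 - rootGap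
> 2 * √cStar`, it stays below `(c0 - rootGap) ^ 2` for violations up to some `Δ > 0`. Retreating
from one near obstacle with speed `K = (dr - c0 * αc (-Δ)) / rootGap` then satisfies the constraints
of all of them: on the cap where `φ = 0` the margin `rootGap` suffices, and off it `φ` is large
enough.

Safety. The direction to an obstacle is a nonnegative combination of normals in its cap, where `φ`
vanishes, with weights summing to some `σ ∈ [1, 1 / c0]`. Summing the constraints bounds the
approach speed; the same argument in the direction of the solution bounds its norm.

Lipschitz dependence. The normals of the feasible polyhedron do not depend on the position, only the
right-hand sides do. Along a segment of right-hand sides, the projection is Lipschitz wherever a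
fixed linearly independent set of active normals carries the multipliers, with a constant depending
on the normals alone. Finitely many such sets occur and the projection is continuous, so the pieces
join (`exists_norm_sub_le_of_isProjection`). In the projected point, projection is nonexpansive. -/

namespace ReshapedQP

open Filter Topology

/-! ### Polyhedra with fixed normals -/

section Polyhedron

variable {E : Type*} [NormedAddCommGroup E] [InnerProductSpace ℝ E]

/-- The set of nonnegative combinations of the elements of `S`. -/
def conicHull (S : Finset E) : Set E :=
  {x | ∃ ρ : E → ℝ, (∀ l, 0 ≤ ρ l) ∧ x = ∑ l ∈ S, ρ l • l}

/-- The polyhedron with normals `S` and right-hand sides `b`. -/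
def polyhedron (S : Finset E) (b : E → ℝ) : Set E :=
  {v | ∀ l ∈ S, inner ℝ l v ≤ b l}

/-- The variational characterization of the projection `x` of `c` on a polyhedron. -/
def IsProjection (S : Finset E) (b : E → ℝ) (c x : E) : Prop :=
  x ∈ polyhedron S b ∧ ∀ w ∈ polyhedron S b, inner ℝ (c - x) (w - x) ≤ 0

/-- `T` is a linearly independent set of active normals that carries the multipliers of `x`. -/
def IsActiveBasis (T : Finset E) (b : E → ℝ) (c x : E) : Prop :=
  LinearIndepOn ℝ id (T : Set E) ∧ (∀ l ∈ T, inner ℝ l x = b l) ∧ c - x ∈ conicHull T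

theorem polyhedron_convex (S : Finset E) (b : E → ℝ) : Convex ℝ (polyhedron S b) := by
  intro x hx y hy s t hs ht hst l hl
  rw [inner_add_right, inner_smul_right, inner_smul_right]
  calc s * inner ℝ l x + t * inner ℝ l y ≤ s * b l + t * b l := by
        gcongr
        · exact hx l hl
        · exact hy l hl
    _ = b l := by rw [← add_mul, hst, one_mul]

theorem polyhedron_isClosed (S : Finset E) (b : E → ℝ) : IsClosed (polyhedron S b) := by
  have : polyhedron S b = ⋂ l ∈ S, {v | inner ℝ l v ≤ b l} := by
    ext v; simp [polyhedron]
  rw [this]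
  exact isClosed_biInter fun l _ => isClosed_le (by fun_prop) continuous_const

/-- Carathéodory's theorem for conic hulls. -/
theorem exists_linearIndepOn_mem_conicHull (S : Finset E) :
    ∀ x ∈ conicHull S, ∃ T ⊆ S, LinearIndepOn ℝ id (T : Set E) ∧ x ∈ conicHull T := by
  classical
  induction S using Finset.strongInduction with
  | H S ih =>
    rintro x ⟨ρ, hρ, rfl⟩
    by_cases hS : LinearIndepOn ℝ id (S : Set E)
    · exact ⟨S, subset_rfl, hS, ρ, hρ, rfl⟩
    have : ∃ g : E → ℝ, ∑ l ∈ S, g l • l = 0 ∧ ∃ l ∈ S, 0 < g l := by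
      rw [linearIndepOn_finset_iff] at hS
      push Not at hS
      obtain ⟨g, hg, l, hl, hgl⟩ := hS
      rcases lt_or_gt_of_ne hgl with h | h
      · refine ⟨-g, ?_, l, hl, by simpa using h⟩
        simpa using hg
      · exact ⟨g, hg, l, hl, h⟩
    obtain ⟨g, hg, l₁, hl₁, hgl₁⟩ := this
    -- Ratio test: subtracting the multiple `ρ l₀ / g l₀` of the relation `g` makes the coefficient
    -- of `l₀` vanish and keeps the others nonnegative.
    obtain ⟨l₀, hl₀, hmin⟩ := (S.filter fun l => 0 < g l).exists_min_image (fun l => ρ l / g l)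
      ⟨l₁, by simp [hl₁, hgl₁]⟩
    rw [Finset.mem_filter] at hl₀
    have hmem : ∑ l ∈ S, ρ l • l ∈ conicHull (S.erase l₀) := by
      refine ⟨fun l => if l ∈ S then ρ l - ρ l₀ / g l₀ * g l else 0, fun l => ?_, ?_⟩
      · dsimp only
        split_ifs with hl
        · rcases le_or_gt (g l) 0 with h | h
          · have := mul_nonneg (div_nonneg (hρ l₀) hl₀.2.le) (neg_nonneg.2 h)
            linarith [hρ l]
          · have := hmin l (by simp [hl, h])
            rw [le_div_iff₀ h] at this
            linarith
        · exact le_rfl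
      · have h0 : ρ l₀ - ρ l₀ / g l₀ * g l₀ = 0 := by
          rw [div_mul_cancel₀ _ hl₀.2.ne', sub_self]
        calc ∑ l ∈ S, ρ l • l = ∑ l ∈ S, (ρ l - ρ l₀ / g l₀ * g l) • l := by
              simp only [sub_smul, mul_smul, Finset.sum_sub_distrib, ← Finset.smul_sum, hg,
                smul_zero, sub_zero]
          _ = ∑ l ∈ S.erase l₀, (ρ l - ρ l₀ / g l₀ * g l) • l := by
              rw [← Finset.add_sum_erase _ _ hl₀.1, h0, zero_smul, zero_add]
          _ = _ := Finset.sum_congr rfl fun l hl => by simp [Finset.mem_of_mem_erase hl]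
    obtain ⟨T, hT, hT'⟩ := ih _ (Finset.erase_ssubset hl₀.1) _ hmem
    exact ⟨T, hT.trans (Finset.erase_subset _ _), hT'⟩

theorem injective_sum_smul_of_linearIndepOn {T : Finset E} (hT : LinearIndepOn ℝ id (T : Set E)) :
    Function.Injective (Fintype.linearCombination ℝ fun l : T => (l : E)) :=
  LinearIndependent.fintypeLinearCombination_injective hT

/-- An injective linear map on a finite-dimensional space is bounded below; `T.card` passes from the
sup norm of the coefficients to their sum. -/
theorem exists_sum_abs_le_of_linearIndepOn {T : Finset E}
    (hT : LinearIndepOn ℝ id (T : Set E)) :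
    ∃ C : ℝ, 0 ≤ C ∧ ∀ μ : E → ℝ, ∑ l ∈ T, |μ l| ≤ C * ‖∑ l ∈ T, μ l • l‖ := by
  obtain ⟨K, -, hK⟩ := LinearMap.exists_antilipschitzWith _
    (LinearMap.ker_eq_bot.2 (injective_sum_smul_of_linearIndepOn hT))
  refine ⟨T.card * K, by positivity, fun μ => ?_⟩
  have h := hK.le_mul_norm (map_zero _) (fun l : T => μ l)
  simp only [Fintype.linearCombination_apply] at h
  rw [Finset.sum_coe_sort T (fun l => μ l • l)] at h
  calc ∑ l ∈ T, |μ l| ≤ ∑ l ∈ T, ‖fun l : T => μ l‖ := by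
        refine Finset.sum_le_sum fun l hl => ?_
        exact norm_le_pi_norm (fun l : T => μ l) ⟨l, hl⟩
    _ = T.card * ‖fun l : T => μ l‖ := by simp
    _ ≤ _ := by rw [mul_assoc]; gcongr

/-- This constant, uniform over the independent subsets, becomes the Lipschitz constant of the
projection. -/
theorem exists_sum_abs_le (S : Finset E) :
    ∃ C : ℝ, 0 ≤ C ∧ ∀ T ⊆ S, LinearIndepOn ℝ id (T : Set E) →
      ∀ μ : E → ℝ, ∑ l ∈ T, |μ l| ≤ C * ‖∑ l ∈ T, μ l • l‖ := by
  classical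
  have h : ∀ T : Finset E, ∃ C : ℝ, 0 ≤ C ∧ (LinearIndepOn ℝ id (T : Set E) →
      ∀ μ : E → ℝ, ∑ l ∈ T, |μ l| ≤ C * ‖∑ l ∈ T, μ l • l‖) := by
    intro T
    by_cases hT : LinearIndepOn ℝ id (T : Set E)
    · obtain ⟨C, hC, h⟩ := exists_sum_abs_le_of_linearIndepOn hT
      exact ⟨C, hC, fun _ => h⟩
    · exact ⟨0, le_rfl, fun h => absurd h hT⟩
  choose C hC h using h
  refine ⟨∑ T ∈ S.powerset, C T, Finset.sum_nonneg fun T _ => hC T, fun T hTS hT μ => ?_⟩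
  refine (h T hT μ).trans ?_
  gcongr
  exact Finset.single_le_sum (f := C) (fun T _ => hC T) (Finset.mem_powerset.2 hTS)

/-- The cone is the image of the closed orthant under a closed embedding. -/
theorem conicHull_isClosed_of_linearIndepOn {T : Finset E}
    (hT : LinearIndepOn ℝ id (T : Set E)) : IsClosed (conicHull T) := by
  classical
  have h := (LinearMap.isClosedEmbedding_of_injective
    (LinearMap.ker_eq_bot.2 (injective_sum_smul_of_linearIndepOn hT))).isClosedMap
      (Set.Ici 0) isClosed_Ici
  convert h using 1
  ext x
  simp only [conicHull, Set.mem_ofPred_eq, Set.mem_image, Set.mem_Ici,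
    Fintype.linearCombination_apply]
  constructor
  · rintro ⟨ρ, hρ, rfl⟩
    exact ⟨fun l => ρ l, fun l => hρ l, Finset.sum_coe_sort T (fun l => ρ l • l)⟩
  · rintro ⟨g, hg, rfl⟩
    refine ⟨fun l => if hl : l ∈ T then g ⟨l, hl⟩ else 0, fun l => ?_, ?_⟩
    · dsimp only
      split_ifs with hl
      · exact hg ⟨l, hl⟩
      · exact le_rfl
    · rw [← Finset.sum_coe_sort T]
      simp

theorem conicHull_mono {S T : Finset E} (h : T ⊆ S) : conicHull T ⊆ conicHull S := by
  classical
  rintro x ⟨ρ, hρ, rfl⟩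
  refine ⟨fun l => if l ∈ T then ρ l else 0, fun l => ?_, ?_⟩
  · dsimp only
    split_ifs
    exacts [hρ l, le_rfl]
  · simp only [ite_smul, zero_smul, Finset.sum_ite_mem, Finset.inter_eq_right.2 h]

/-- By Carathéodory the cone is a finite union of cones over independent subsets. -/
theorem conicHull_isClosed (S : Finset E) : IsClosed (conicHull S) := by
  have : conicHull S =
      ⋃ T ∈ {T : Finset E | T ⊆ S ∧ LinearIndepOn ℝ id (T : Set E)}, conicHull T := by
    ext x
    simp only [Set.mem_iUnion, Set.mem_ofPred_eq, exists_prop]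
    constructor
    · intro hx
      obtain ⟨T, h₁, h₂, h₃⟩ := exists_linearIndepOn_mem_conicHull S x hx
      exact ⟨T, ⟨h₁, h₂⟩, h₃⟩
    · rintro ⟨T, ⟨h₁, -⟩, h₃⟩
      exact conicHull_mono h₁ h₃
  rw [this]
  refine Set.Finite.isClosed_biUnion ?_ fun T hT => conicHull_isClosed_of_linearIndepOn hT.2
  exact S.powerset.finite_toSet.subset fun T hT => by simpa using hT.1

theorem zero_mem_conicHull (S : Finset E) : (0 : E) ∈ conicHull S :=
  ⟨0, fun _ => le_rfl, by simp⟩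

theorem add_mem_conicHull {S : Finset E} {x y : E} (hx : x ∈ conicHull S)
    (hy : y ∈ conicHull S) : x + y ∈ conicHull S := by
  obtain ⟨ρ, hρ, rfl⟩ := hx
  obtain ⟨σ, hσ, rfl⟩ := hy
  exact ⟨fun l => ρ l + σ l, fun l => add_nonneg (hρ l) (hσ l), by
    simp only [add_smul, Finset.sum_add_distrib]⟩

theorem smul_mem_conicHull {S : Finset E} {x : E} {t : ℝ} (ht : 0 ≤ t) (hx : x ∈ conicHull S) :
    t • x ∈ conicHull S := by
  obtain ⟨ρ, hρ, rfl⟩ := hx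
  refine ⟨fun l => t * ρ l, fun l => mul_nonneg ht (hρ l), ?_⟩
  simp only [mul_smul, ← Finset.smul_sum]

theorem subset_conicHull {S : Finset E} {l : E} (hl : l ∈ S) : l ∈ conicHull S := by
  classical
  refine ⟨Pi.single l 1, fun m => ?_, ?_⟩
  · by_cases hm : m = l <;> simp [hm]
  · simp [Pi.single_apply, hl]

/-- Farkas' lemma for finitely generated cones. -/
theorem mem_conicHull_of_forall_inner_nonpos [CompleteSpace E] {S : Finset E} {x : E}
    (h : ∀ d : E, (∀ l ∈ S, inner ℝ l d ≤ 0) → inner ℝ x d ≤ 0) : x ∈ conicHull S := by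
  let C : ProperCone ℝ E :=
    { carrier := conicHull S
      add_mem' := add_mem_conicHull
      zero_mem' := zero_mem_conicHull S
      smul_mem' := fun c _ hx => smul_mem_conicHull c.2 hx
      isClosed' := conicHull_isClosed S }
  by_contra hx
  obtain ⟨y, hy, hxy⟩ := C.hyperplane_separation' (x₀ := x) hx
  have := h (-y) fun l hl => by
    rw [inner_neg_right, neg_nonpos]
    exact hy l (subset_conicHull hl)
  rw [inner_neg_right] at this
  linarith

/-- The Karush–Kuhn–Tucker conditions for the projection on a polyhedron, with linearly independent
active normals. -/
theorem IsProjection.exists_isActiveBasis [CompleteSpace E] {S : Finset E} {b : E → ℝ} {c x : E}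
    (h : IsProjection S b c x) : ∃ T ⊆ S, IsActiveBasis T b c x := by
  classical
  have hc : c - x ∈ conicHull (S.filter fun l => inner ℝ l x = b l) := by
    refine mem_conicHull_of_forall_inner_nonpos fun d hd => ?_
    -- Active constraints are not violated along `d`, and inactive ones have slack for small `t`.
    have hev : ∀ᶠ t : ℝ in 𝓝[>] 0, x + t • d ∈ polyhedron S b := by
      simp only [polyhedron, Set.mem_ofPred_eq]
      rw [eventually_all_finset]
      intro l hl
      by_cases hlb : inner ℝ l x = b l
      · filter_upwards [self_mem_nhdsWithin] with t ht
        rw [inner_add_right, inner_smul_right, hlb]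
        have := mul_nonneg (Set.mem_Ioi.1 ht).le (neg_nonneg.2 (hd l (by simp [hl, hlb])))
        linarith
      · have hlt := lt_of_le_of_ne (h.1 l hl) hlb
        have hcont : Continuous fun t : ℝ => inner ℝ l (x + t • d) := by fun_prop
        have := (hcont.tendsto 0).eventually_lt_const (u := b l) (by simpa using hlt)
        exact (this.filter_mono nhdsWithin_le_nhds).mono fun t ht => ht.le
    obtain ⟨t, ht, ht0⟩ := (hev.and self_mem_nhdsWithin).exists
    have := h.2 _ ht
    rw [add_sub_cancel_left, inner_smul_right] at this
    exact nonpos_of_mul_nonpos_right this ht0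
  obtain ⟨T, hTS, hT, hcT⟩ := exists_linearIndepOn_mem_conicHull _ _ hc
  exact ⟨T, hTS.trans (Finset.filter_subset _ _), hT,
    fun l hl => (Finset.mem_filter.1 (hTS hl)).2, hcT⟩

/-- With a common `T`, the difference `x₁ - x₂` lies in the span of `T` while its inner products
with `T` are differences of right-hand sides. Expanding its square in these terms leaves one factor
of the norm to cancel. -/
theorem IsActiveBasis.norm_sub_le {T : Finset E} {C : ℝ}
    (hC : ∀ μ : E → ℝ, ∑ l ∈ T, |μ l| ≤ C * ‖∑ l ∈ T, μ l • l‖) {b₁ b₂ : E → ℝ} {c x₁ x₂ : E}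
    {m : ℝ} (hC0 : 0 ≤ C) (hm : ∀ l ∈ T, |b₁ l - b₂ l| ≤ m) (hm0 : 0 ≤ m)
    (h₁ : IsActiveBasis T b₁ c x₁) (h₂ : IsActiveBasis T b₂ c x₂) : ‖x₁ - x₂‖ ≤ C * m := by
  obtain ⟨-, ha₁, ρ, -, hρ⟩ := h₁
  obtain ⟨-, ha₂, σ, -, hσ⟩ := h₂
  have hx : x₁ - x₂ = ∑ l ∈ T, (σ l - ρ l) • l := by
    simp only [sub_smul, Finset.sum_sub_distrib, ← hρ, ← hσ]
    abel
  have hsq : ‖x₁ - x₂‖ * ‖x₁ - x₂‖ ≤ C * m * ‖x₁ - x₂‖ := by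
    calc ‖x₁ - x₂‖ * ‖x₁ - x₂‖ = inner ℝ (∑ l ∈ T, (σ l - ρ l) • l) (x₁ - x₂) := by
          rw [← hx, real_inner_self_eq_norm_mul_norm]
      _ = ∑ l ∈ T, (σ l - ρ l) * (b₁ l - b₂ l) := by
          rw [sum_inner]
          refine Finset.sum_congr rfl fun l hl => ?_
          rw [real_inner_smul_left, inner_sub_right, ha₁ l hl, ha₂ l hl]
      _ ≤ ∑ l ∈ T, |σ l - ρ l| * m := by
          refine Finset.sum_le_sum fun l hl => (le_abs_self _).trans ?_
          rw [abs_mul]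
          gcongr
          exact hm l hl
      _ = (∑ l ∈ T, |σ l - ρ l|) * m := by rw [Finset.sum_mul]
      _ ≤ C * ‖x₁ - x₂‖ * m := by
          gcongr
          rw [hx]
          exact hC fun l => σ l - ρ l
      _ = C * m * ‖x₁ - x₂‖ := by ring
  rcases (norm_nonneg (x₁ - x₂)).eq_or_lt with h | h
  · rw [← h]; positivity
  · exact le_of_mul_le_mul_right hsq h

/-- Here `x₂` is merely feasible, so the active sets may differ. The weaker estimate gives Hölder
continuity of exponent 1/2, enough for the continuity needed to join the pieces. -/
theorem IsActiveBasis.inner_le {S T : Finset E} (hTS : T ⊆ S) {C : ℝ}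
    (hC : ∀ μ : E → ℝ, ∑ l ∈ T, |μ l| ≤ C * ‖∑ l ∈ T, μ l • l‖) {b₁ b₂ : E → ℝ} {c x₁ x₂ : E}
    {m : ℝ} (hm : ∀ l ∈ S, |b₁ l - b₂ l| ≤ m) (hm0 : 0 ≤ m)
    (h₁ : IsActiveBasis T b₁ c x₁) (h₂ : x₂ ∈ polyhedron S b₂) :
    inner ℝ (c - x₁) (x₂ - x₁) ≤ C * m * ‖c - x₁‖ := by
  obtain ⟨-, ha₁, ρ, hρ0, hρ⟩ := h₁
  calc inner ℝ (c - x₁) (x₂ - x₁) = ∑ l ∈ T, ρ l * (inner ℝ l x₂ - inner ℝ l x₁) := by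
        rw [hρ, sum_inner]
        simp only [real_inner_smul_left, inner_sub_right, mul_sub]
    _ ≤ ∑ l ∈ T, |ρ l| * m := by
        refine Finset.sum_le_sum fun l hl => ?_
        rw [abs_of_nonneg (hρ0 l)]
        refine mul_le_mul_of_nonneg_left ?_ (hρ0 l)
        have := neg_abs_le (b₁ l - b₂ l)
        linarith [ha₁ l hl, h₂ l (hTS hl), hm l (hTS hl)]
    _ = (∑ l ∈ T, |ρ l|) * m := by rw [Finset.sum_mul]
    _ ≤ C * ‖c - x₁‖ * m := by
        gcongr
        rw [hρ]
        exact hC ρ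
    _ = C * m * ‖c - x₁‖ := by ring

theorem exists_isProjection [CompleteSpace E] {S : Finset E} {b : E → ℝ}
    (h : (polyhedron S b).Nonempty) (c : E) : ∃ x, IsProjection S b c x := by
  obtain ⟨x, hx, hx'⟩ := exists_norm_eq_iInf_of_complete_convex h
    (polyhedron_isClosed S b).isComplete (polyhedron_convex S b) c
  exact ⟨x, hx, (norm_eq_iInf_iff_real_inner_le_zero (polyhedron_convex S b) hx).1 hx'⟩

theorem isProjection_iff {S : Finset E} {b : E → ℝ} {c x : E} :
    IsProjection S b c x ↔
      x ∈ polyhedron S b ∧ ∀ w ∈ polyhedron S b, ‖x - c‖ ^ 2 ≤ ‖w - c‖ ^ 2 := by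
  refine and_congr_right fun hx => ?_
  rw [← norm_eq_iInf_iff_real_inner_le_zero (polyhedron_convex S b) hx]
  have hbdd : BddBelow (Set.range fun w : polyhedron S b => ‖c - w‖) :=
    ⟨0, by rintro _ ⟨w, rfl⟩; exact norm_nonneg _⟩
  have : Nonempty (polyhedron S b) := ⟨⟨x, hx⟩⟩
  constructor
  · intro h w hw
    gcongr 1
    rw [norm_sub_rev x, norm_sub_rev w, h]
    exact ciInf_le hbdd ⟨w, hw⟩
  · intro h
    refine le_antisymm (le_ciInf fun w => ?_) (ciInf_le hbdd ⟨x, hx⟩)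
    have := h w w.2
    rw [norm_sub_rev c, norm_sub_rev c]
    exact le_of_sq_le_sq this (norm_nonneg _)

/-- Add the two variational inequalities, each tested at the other point. The case `c₁ = c₂` gives
uniqueness. -/
theorem IsProjection.norm_sub_le {S : Finset E} {b : E → ℝ} {c₁ c₂ x₁ x₂ : E}
    (h₁ : IsProjection S b c₁ x₁) (h₂ : IsProjection S b c₂ x₂) : ‖x₁ - x₂‖ ≤ ‖c₁ - c₂‖ := by
  have e₁ := h₁.2 x₂ h₂.1
  have e₂ := h₂.2 x₁ h₁.1
  have h : inner ℝ (x₁ - x₂) (x₁ - x₂) ≤ inner ℝ (c₁ - c₂) (x₁ - x₂) := by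
    have : inner ℝ (c₁ - c₂) (x₁ - x₂) - inner ℝ (x₁ - x₂) (x₁ - x₂) =
        -inner ℝ (c₁ - x₁) (x₂ - x₁) - inner ℝ (c₂ - x₂) (x₁ - x₂) := by
      rw [← neg_sub x₁ x₂, inner_neg_right, neg_neg, ← inner_sub_left, ← inner_sub_left]
      congr 1
      abel
    linarith
  rw [real_inner_self_eq_norm_mul_norm] at h
  have := h.trans (real_inner_le_norm _ _)
  rcases (norm_nonneg (x₁ - x₂)).eq_or_lt with h | h
  · rw [← h]; positivity
  · exact le_of_mul_le_mul_right this h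

end Polyhedron

/-! ### Lipschitz dependence of projections on the right-hand sides -/

/-- A continuous function that is `C`-Lipschitz on each of finitely many sets covering `[0, 1]` is
`C`-Lipschitz between the endpoints. -/
theorem norm_sub_le_of_finite_cover {E ι : Type*} [NormedAddCommGroup E] [Finite ι] {f : ℝ → E}
    (hf : ContinuousOn f (Set.Icc 0 1)) (A : ι → Set ℝ)
    (hA : ∀ t ∈ Set.Icc (0 : ℝ) 1, ∃ i, t ∈ A i) {C : ℝ}
    (hC : ∀ i, ∀ s ∈ Set.Icc (0 : ℝ) 1, ∀ t ∈ Set.Icc (0 : ℝ) 1, s ∈ A i → t ∈ A i →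
      ‖f s - f t‖ ≤ C * |s - t|) : ‖f 1 - f 0‖ ≤ C := by
  -- The mean value inequality used below asks for a strict bound on the slope, hence `C' > C`.
  refine le_of_forall_gt_imp_ge_of_dense fun C' hC' => ?_
  have key := image_norm_le_of_liminf_right_slope_norm_lt_deriv_boundary (a := 0) (b := 1)
    (f := fun t => f t - f 0) (f' := fun _ => C) (B := fun t => C' * t) (B' := fun _ => C')
    (hf.sub continuousOn_const) ?_ (by simp) (by fun_prop)
    (fun x _ => by simpa using ((hasDerivAt_id x).const_mul C').hasDerivWithinAt)
    (fun _ _ _ => hC')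
  · simpa using key (Set.right_mem_Icc.2 zero_le_one)
  intro x hx r hr
  have hI : ∀ᶠ z in 𝓝[>] x, z ∈ Set.Ioc x 1 := Ioc_mem_nhdsGT hx.2
  -- One of the finitely many sets accumulates at `x` from the right.
  obtain ⟨i, hi⟩ : ∃ i, ∃ᶠ z in 𝓝[>] x, z ∈ A i := by
    by_contra! hcon
    have : ∀ i, ∀ᶠ z in 𝓝[>] x, z ∉ A i := hcon
    rw [← eventually_all] at this
    obtain ⟨z, hz, hz'⟩ := (this.and hI).exists
    obtain ⟨i, hzi⟩ := hA z ⟨hx.1.trans hz'.1.le, hz'.2⟩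
    exact hz i hzi
  refine (hi.and_eventually hI).mono fun z hz => ?_
  have hxI : x ∈ Set.Icc (0 : ℝ) 1 := ⟨hx.1, hx.2.le⟩
  have hzI : z ∈ Set.Icc (0 : ℝ) 1 := ⟨hx.1.trans hz.2.1.le, hz.2.2⟩
  -- The point `x` need not lie in `A i`; the bound reaches it as a limit of points `y` of `A i`, by
  -- continuity of `f`.
  have hle : ‖f z - f x‖ ≤ C * |z - x| := by
    have hmap : Tendsto f (𝓝[>] x) (𝓝 (f x)) :=
      (hf x hxI).mono_left (by
        rw [← nhdsWithin_Ioc_eq_nhdsGT hx.2]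
        exact nhdsWithin_mono _ fun y hy => ⟨hx.1.trans hy.1.le, hy.2⟩)
    have hid : Tendsto (fun y : ℝ => y) (𝓝[>] x) (𝓝 x) := tendsto_id.mono_left nhdsWithin_le_nhds
    have hlim : Tendsto (fun y => C * |z - y| - ‖f z - f y‖) (𝓝[>] x)
        (𝓝 (C * |z - x| - ‖f z - f x‖)) :=
      ((hid.const_sub z).abs.const_mul C).sub (hmap.const_sub (f z)).norm
    have := isClosed_Ici.mem_of_frequently_of_tendsto (x := C * |z - x| - ‖f z - f x‖)
      (s := Set.Ici (0 : ℝ)) ((hi.and_eventually hI).mono fun y hy => ?_) hlim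
    · simpa using this
    · exact sub_nonneg.2 (hC i z hzI y ⟨hx.1.trans hy.2.1.le, hy.2.2⟩ hz.1 hy.1)
  have hpos : 0 < z - x := sub_pos.2 hz.2.1
  refine lt_of_le_of_lt ?_ hr
  rw [slope_def_field, div_le_iff₀ hpos]
  rw [abs_of_pos hpos] at hle
  refine le_trans ?_ hle
  have := norm_sub_norm_le (f z - f 0) (f x - f 0)
  simpa using this

section Polyhedron

variable {E : Type*} [NormedAddCommGroup E] [InnerProductSpace ℝ E]

/-- The projection on a polyhedron depends on the right-hand sides in a Lipschitz way. -/
theorem exists_norm_sub_le_of_isProjection [CompleteSpace E] (S : Finset E) :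
    ∃ C : ℝ, 0 ≤ C ∧ ∀ (b₁ b₂ : E → ℝ) (c x₁ x₂ : E) (m : ℝ), 0 ≤ m →
      (∀ l ∈ S, |b₁ l - b₂ l| ≤ m) → IsProjection S b₁ c x₁ → IsProjection S b₂ c x₂ →
      ‖x₁ - x₂‖ ≤ C * m := by
  obtain ⟨C, hC0, hC⟩ := exists_sum_abs_le S
  refine ⟨C, hC0, fun b₁ b₂ c x₁ x₂ m hm0 hm h₁ h₂ => ?_⟩
  let b : ℝ → E → ℝ := fun t l => (1 - t) * b₂ l + t * b₁ l
  have hb : ∀ s t, ∀ l ∈ S, |b s l - b t l| ≤ |s - t| * m := by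
    intro s t l hl
    have : b s l - b t l = (s - t) * (b₁ l - b₂ l) := by simp only [b]; ring
    rw [this, abs_mul]
    gcongr
    exact hm l hl
  -- The segment from `x₂` to `x₁` is feasible for the interpolated data, so the projections `f t`
  -- exist and stay within `R` of `c`.
  let y : ℝ → E := fun t => (1 - t) • x₂ + t • x₁
  have hy : ∀ t ∈ Set.Icc (0 : ℝ) 1, y t ∈ polyhedron S (b t) := by
    intro t ht l hl
    simp only [y, b, inner_add_right, inner_smul_right]
    gcongr
    · linarith [ht.2]
    · exact h₂.1 l hl
    · exact ht.1
    · exact h₁.1 l hl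
  have hex : ∀ t : ℝ, ∃ x, t ∈ Set.Icc (0 : ℝ) 1 → IsProjection S (b t) c x := by
    intro t
    by_cases ht : t ∈ Set.Icc (0 : ℝ) 1
    · obtain ⟨x, hx⟩ := exists_isProjection ⟨_, hy t ht⟩ c
      exact ⟨x, fun _ => hx⟩
    · exact ⟨0, fun h => absurd h ht⟩
  choose f hf using hex
  have huniq : ∀ {b' : E → ℝ} {z z' : E}, IsProjection S b' c z → IsProjection S b' c z' →
      z = z' := fun h h' => by
    have := h.norm_sub_le h'
    rw [sub_self, norm_zero] at this
    exact sub_eq_zero.1 (norm_le_zero_iff.1 this)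
  have e0 : f 0 = x₂ := huniq (hf 0 (by simp)) (by simpa [b] using h₂)
  have e1 : f 1 = x₁ := huniq (hf 1 (by simp)) (by simpa [b] using h₁)
  let R := ‖c - x₂‖ + ‖c - x₁‖
  have hR : ∀ t ∈ Set.Icc (0 : ℝ) 1, ‖c - f t‖ ≤ R := by
    intro t ht
    have hle := le_of_sq_le_sq ((isProjection_iff.1 (hf t ht)).2 _ (hy t ht)) (norm_nonneg _)
    rw [norm_sub_rev] at hle
    refine hle.trans ?_
    have : y t - c = (1 - t) • (x₂ - c) + t • (x₁ - c) := by
      simp only [y, smul_sub, sub_smul, one_smul]; abel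
    rw [this]
    refine (norm_add_le _ _).trans ?_
    rw [norm_smul, norm_smul, Real.norm_of_nonneg (sub_nonneg.2 ht.2), Real.norm_of_nonneg ht.1,
      norm_sub_rev x₂, norm_sub_rev x₁]
    exact add_le_add (mul_le_of_le_one_left (norm_nonneg _) (by linarith [ht.1]))
      (mul_le_of_le_one_left (norm_nonneg _) ht.2)
  have hhol : ∀ s ∈ Set.Icc (0 : ℝ) 1, ∀ t ∈ Set.Icc (0 : ℝ) 1,
      ‖f s - f t‖ ^ 2 ≤ 2 * (C * m * R) * |s - t| := by
    have half : ∀ s ∈ Set.Icc (0 : ℝ) 1, ∀ t ∈ Set.Icc (0 : ℝ) 1,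
        inner ℝ (c - f s) (f t - f s) ≤ C * m * R * |s - t| := by
      intro s hs t ht
      obtain ⟨T, hTS, hT⟩ := (hf s hs).exists_isActiveBasis
      refine (hT.inner_le hTS (hC T hTS hT.1) (hb s t) (by positivity) (hf t ht).1).trans ?_
      calc C * (|s - t| * m) * ‖c - f s‖ ≤ C * (|s - t| * m) * R := by gcongr; exact hR s hs
        _ = _ := by ring
    intro s hs t ht
    have e₁ := half s hs t ht
    have e₂ := half t ht s hs
    rw [abs_sub_comm] at e₂
    have : ‖f s - f t‖ ^ 2 =
        inner ℝ (c - f s) (f t - f s) + inner ℝ (c - f t) (f s - f t) := by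
      rw [← real_inner_self_eq_norm_sq, ← neg_sub (f s) (f t), inner_neg_right, neg_add_eq_sub,
        ← inner_sub_left]
      congr 1
      abel
    linarith
  have hcont : ContinuousOn f (Set.Icc 0 1) := by
    intro t ht
    rw [ContinuousWithinAt, tendsto_iff_norm_sub_tendsto_zero]
    have hlim : Tendsto (fun s => √(2 * (C * m * R) * |s - t|)) (𝓝[Set.Icc 0 1] t) (𝓝 0) := by
      have : Continuous fun s => √(2 * (C * m * R) * |s - t|) := by fun_prop
      simpa using (this.tendsto t).mono_left nhdsWithin_le_nhds
    refine squeeze_zero' (Eventually.of_forall fun s => norm_nonneg _) ?_ hlim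
    filter_upwards [self_mem_nhdsWithin] with s hs
    exact Real.le_sqrt_of_sq_le (hhol s hs t ht)
  -- The cover of `[0, 1]` is indexed by subsets of `S`: each `t` belongs to the sets `T` that are
  -- active bases at `f t`.
  have := norm_sub_le_of_finite_cover hcont
    (fun T : S.powerset => {t | IsActiveBasis T.1 (b t) c (f t)}) ?_ (C := C * m) ?_
  · rwa [e0, e1] at this
  · intro t ht
    obtain ⟨T, hTS, hT⟩ := (hf t ht).exists_isActiveBasis
    exact ⟨⟨T, Finset.mem_powerset.2 hTS⟩, hT⟩
  · rintro ⟨T, hTS⟩ s hs t ht hsT htT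
    rw [Finset.mem_powerset] at hTS
    refine (IsActiveBasis.norm_sub_le (hC T hTS hsT.1) hC0 (fun l hl => hb s t l (hTS hl))
      (by positivity) hsT htT).trans_eq ?_
    ring

end Polyhedron

/-! ### Existence of positive bases -/

/-- Near every unit vector, finitely many unit vectors do as a positive basis. -/
theorem exists_finset_eventually_mem_conicHull {n : ℕ} {c0 : ℝ} (h0 : 0 < c0) (h1 : c0 < 1)
    {u : Vec n} (hu : ‖u‖ = 1) :
    ∃ F : Finset (Vec n), (∀ l ∈ F, ‖l‖ = 1) ∧ n ≤ F.card ∧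
      ∀ᶠ w in 𝓝 u, (∀ l ∈ F, c0 ≤ inner ℝ l w) ∧ w ∈ conicHull F := by
  classical
  have hn : (n : ℝ) ≠ 0 := by
    rintro h
    rw [Nat.cast_eq_zero] at h
    subst h
    rw [Subsingleton.elim u 0, norm_zero] at hu
    exact zero_ne_one hu
  have hn0 : (0 : ℝ) < n := lt_of_le_of_ne (Nat.cast_nonneg n) hn.symm
  -- The last inequality keeps the normalized perturbations of `u` strictly inside its cap.
  obtain ⟨ε, hε, hε1, hεc⟩ : ∃ ε : ℝ, 0 < ε ∧ ε < 1 ∧ c0 * (1 + ε) < 1 - ε :=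
    ⟨(1 - c0) / 4, by linarith, by linarith, by nlinarith⟩
  let e : Fin n → Vec n := fun i => EuclideanSpace.single i 1
  let g : Fin n × Bool → Vec n := fun p => u + (if p.2 then ε else -ε) • e p.1
  have hdev : ∀ p : Fin n × Bool, ‖(if p.2 then ε else -ε) • e p.1‖ = ε := by
    rintro ⟨i, b⟩
    cases b <;> simp [e, norm_smul, abs_of_pos hε]
  have hle : ∀ p, ‖g p‖ ≤ 1 + ε := fun p => by
    refine (norm_add_le _ _).trans ?_
    rw [hu, hdev]
  have hinner : ∀ p, 1 - ε ≤ inner ℝ (g p) u := fun p => by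
    have h2 := (abs_le.1 (abs_real_inner_le_norm ((if p.2 then ε else -ε) • e p.1) u)).1
    rw [hdev, hu] at h2
    simp only [g, inner_add_left, real_inner_self_eq_norm_sq, hu]
    linarith
  have hpos : ∀ p, 0 < ‖g p‖ := fun p => by
    rw [norm_pos_iff]
    intro h
    have := hinner p
    rw [h, inner_zero_left] at this
    linarith
  let F : Finset (Vec n) := Finset.univ.image fun p => ‖g p‖⁻¹ • g p
  have hgF : ∀ p, g p ∈ conicHull F := fun p => by
    have : ‖g p‖⁻¹ • g p ∈ F := Finset.mem_image_of_mem _ (Finset.mem_univ p)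
    have := smul_mem_conicHull (norm_nonneg (g p)) (subset_conicHull this)
    rwa [smul_smul, mul_inv_cancel₀ (hpos p).ne', one_smul] at this
  have hcone : ∀ᶠ w in 𝓝 u, w ∈ conicHull F := by
    filter_upwards [Metric.ball_mem_nhds u (div_pos hε hn0)] with w hw
    rw [Metric.mem_ball, dist_eq_norm] at hw
    have hwi : ∀ i, |(w - u) i| ≤ ε / n := fun i => by
      have := PiLp.norm_apply_le (w - u) i
      rw [Real.norm_eq_abs] at this
      exact this.trans hw.le
    -- The weights `1 / (2 * n)` reproduce `u`; shifting weight between `u + ε • e i` and `u - ε • e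
    -- i` produces the `i`-th coordinate of `w - u`. They stay nonnegative on the ball of radius `ε
    -- / n`.
    have key : w = ∑ i, ((1 / (2 * n) + (w - u) i / (2 * ε)) • g (i, true) +
        (1 / (2 * n) - (w - u) i / (2 * ε)) • g (i, false)) := by
      have : ∀ i, (1 / (2 * n) + (w - u) i / (2 * ε)) • g (i, true) +
          (1 / (2 * n) - (w - u) i / (2 * ε)) • g (i, false) =
          (1 / n : ℝ) • u + (w - u) i • e i := by
        intro i
        simp only [g, if_true, Bool.false_eq_true, if_false]
        match_scalars <;> field_simp <;> ring
      simp only [this, Finset.sum_add_distrib, Finset.sum_const, Finset.card_univ,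
        Fintype.card_fin]
      have hsum : ∑ i, (w - u) i • e i = w - u := by
        have := (EuclideanSpace.basisFun (Fin n) ℝ).sum_repr (w - u)
        simpa [e] using this
      rw [hsum, ← Nat.cast_smul_eq_nsmul ℝ, smul_smul, mul_one_div_cancel hn, one_smul]
      abel
    rw [key]
    refine Finset.sum_induction _ (· ∈ conicHull F) (fun _ _ => add_mem_conicHull)
      (zero_mem_conicHull F) fun i _ => ?_
    have hi := abs_le.1 (hwi i)
    have hquot : 1 / (2 * n) = (ε / n) / (2 * ε) := by field_simp
    refine add_mem_conicHull (smul_mem_conicHull ?_ (hgF _)) (smul_mem_conicHull ?_ (hgF _))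
    · rw [hquot, ← add_div]
      exact div_nonneg (by linarith) (by positivity)
    · rw [hquot, ← sub_div]
      exact div_nonneg (by linarith) (by positivity)
  refine ⟨F, ?_, ?_, ?_⟩
  · intro l hl
    obtain ⟨p, -, rfl⟩ := Finset.mem_image.1 hl
    rw [norm_smul, norm_inv, norm_norm, inv_mul_cancel₀ (hpos p).ne']
  · have hspan : Submodule.span ℝ (F : Set (Vec n)) = ⊤ := by
      refine Submodule.eq_top_of_nonempty_interior' _ ⟨u, mem_interior_iff_mem_nhds.2 ?_⟩
      filter_upwards [hcone] with w hw
      obtain ⟨ρ, -, rfl⟩ := hw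
      exact Submodule.sum_mem _ fun l hl => Submodule.smul_mem _ _ (Submodule.subset_span hl)
    have := finrank_span_finset_le_card (R := ℝ) F
    rwa [Set.finrank, hspan, finrank_top, finrank_euclideanSpace_fin] at this
  · refine Eventually.and ?_ hcone
    rw [eventually_all_finset]
    intro l hl
    obtain ⟨p, -, rfl⟩ := Finset.mem_image.1 hl
    have hcont : Continuous fun w : Vec n => inner ℝ (‖g p‖⁻¹ • g p) w := by fun_prop
    refine ((hcont.tendsto u).eventually_const_lt ?_).mono fun w hw => hw.le
    rw [real_inner_smul_left, inv_mul_eq_div, lt_div_iff₀ (hpos p)]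
    calc c0 * ‖g p‖ ≤ c0 * (1 + ε) := by gcongr; exact hle p
      _ < 1 - ε := hεc
      _ ≤ _ := hinner p

/-- Finitely many of the local families suffice by compactness of the sphere, and extra vectors in a
cap do no harm. -/
theorem exists_isPositiveBasis (n : ℕ) {c0 : ℝ} (h0 : 0 < c0) (h1 : c0 < 1) :
    ∃ L : Finset (Vec n), IsPositiveBasis c0 L := by
  classical
  have hloc : ∀ u : Vec n, ∃ F : Finset (Vec n), ‖u‖ = 1 → (∀ l ∈ F, ‖l‖ = 1) ∧ n ≤ F.card ∧
      ∀ᶠ w in 𝓝 u, (∀ l ∈ F, c0 ≤ inner ℝ l w) ∧ w ∈ conicHull F := fun u => by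
    by_cases hu : ‖u‖ = 1
    · obtain ⟨F, hF⟩ := exists_finset_eventually_mem_conicHull h0 h1 hu
      exact ⟨F, fun _ => hF⟩
    · exact ⟨∅, fun h => absurd h hu⟩
  choose F hF using hloc
  obtain ⟨t, ht, hcov⟩ := (isCompact_sphere (0 : Vec n) 1).elim_nhds_subcover
    (fun u => {w | (∀ l ∈ F u, c0 ≤ inner ℝ l w) ∧ w ∈ conicHull (F u)})
    fun u hu => (hF u (by simpa using hu)).2.2
  have hloc : ∀ w : Vec n, ‖w‖ = 1 → ∃ u ∈ t,
      F u ⊆ (t.biUnion F).filter (fun l => c0 ≤ inner ℝ l w) ∧ w ∈ conicHull (F u) := by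
    intro w hw
    obtain ⟨u, hu, hwu⟩ := Set.mem_iUnion₂.1 (hcov (show w ∈ Metric.sphere 0 1 by simpa using hw))
    exact ⟨u, hu, fun l hl => Finset.mem_filter.2
      ⟨Finset.mem_biUnion.2 ⟨u, hu, hl⟩, hwu.1 l hl⟩, hwu.2⟩
  have hnorm : ∀ u ∈ t, ‖u‖ = 1 := fun u hu => by simpa using ht u hu
  refine ⟨t.biUnion F, ⟨fun l hl => ?_, fun w hw => ?_, fun w hw => ?_⟩⟩
  · obtain ⟨u, hu, hl⟩ := Finset.mem_biUnion.1 hl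
    exact (hF u (hnorm u hu)).1 l hl
  · obtain ⟨u, -, hsub, hmem⟩ := hloc w hw
    exact conicHull_mono hsub hmem
  · obtain ⟨u, hu, hsub, -⟩ := hloc w hw
    exact (hF u (hnorm u hu)).2.1.trans (Finset.card_le_card hsub)

/-! ### Existence of design data -/

/-- The function with slope `a` on the positive half-line and `b` on the negative one. -/
def twoSlope (a b s : ℝ) : ℝ := a * max s 0 + b * min s 0

theorem twoSlope_of_nonneg (a b : ℝ) {s : ℝ} (hs : 0 ≤ s) : twoSlope a b s = a * s := by
  simp [twoSlope, hs]

theorem twoSlope_of_nonpos (a b : ℝ) {s : ℝ} (hs : s ≤ 0) : twoSlope a b s = b * s := by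
  simp [twoSlope, hs]

theorem abs_twoSlope_sub_le {a b : ℝ} (ha : 0 < a) (hb : 0 < b) (s t : ℝ) :
    |twoSlope a b s - twoSlope a b t| ≤ (a + b) * |s - t| := by
  have h₁ := abs_max_sub_max_le_abs s t 0
  have h₂ := abs_min_sub_min_le_max s 0 t 0
  rw [sub_self, abs_zero, max_eq_left (abs_nonneg _)] at h₂
  have : twoSlope a b s - twoSlope a b t =
      a * (max s 0 - max t 0) + b * (min s 0 - min t 0) := by
    simp only [twoSlope]; ring
  rw [this, add_mul]
  refine (abs_add_le _ _).trans ?_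
  rw [abs_mul, abs_mul, abs_of_pos ha, abs_of_pos hb]
  gcongr

theorem twoSlope_lipschitz {a b : ℝ} (ha : 0 < a) (hb : 0 < b) :
    LipschitzWith (a + b).toNNReal (twoSlope a b) :=
  LipschitzWith.of_dist_le_mul fun s t => by
    rw [Real.coe_toNNReal _ (by positivity), Real.dist_eq, Real.dist_eq]
    exact abs_twoSlope_sub_le ha hb s t

theorem twoSlope_strictMono {a b : ℝ} (ha : 0 < a) (hb : 0 < b) : StrictMono (twoSlope a b) := by
  intro s t hst
  rcases le_total 0 s with hs | hs
  · rw [twoSlope_of_nonneg a b hs, twoSlope_of_nonneg a b (hs.trans hst.le)]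
    gcongr
  rcases le_total t 0 with ht | ht
  · rw [twoSlope_of_nonpos a b hs, twoSlope_of_nonpos a b ht]
    gcongr
  · rw [twoSlope_of_nonpos a b hs, twoSlope_of_nonneg a b ht]
    rcases hs.eq_or_lt with rfl | hs
    · simpa using mul_pos ha hst
    · exact (mul_neg_of_pos_of_neg hb hs).trans_le (mul_nonneg ha.le ht)

theorem twoSlope_inv_left {a b : ℝ} (ha : 0 < a) (hb : 0 < b) :
    Function.LeftInverse (twoSlope a⁻¹ b⁻¹) (twoSlope a b) := by
  intro s
  rcases le_total 0 s with hs | hs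
  · rw [twoSlope_of_nonneg a b hs, twoSlope_of_nonneg _ _ (by positivity),
      inv_mul_cancel_left₀ ha.ne']
  · rw [twoSlope_of_nonpos a b hs,
      twoSlope_of_nonpos _ _ (mul_nonpos_of_nonneg_of_nonpos hb.le hs),
      inv_mul_cancel_left₀ hb.ne']

/-- Difference of squares; it turns the lower bound on `c0` into `dr < c0 * (vbar - dr) * rootGap`.
-/
theorem rootGap_mul_add (c dr vbar : ℝ) (hc : 0 ≤ c) (hx : 0 ≤ dr / (vbar - dr)) :
    rootGap c dr vbar * (√c + √(c + dr / (vbar - dr))) = dr / (vbar - dr) := by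
  have h₁ := Real.mul_self_sqrt hc
  have h₂ := Real.mul_self_sqrt (add_nonneg hc hx)
  rw [rootGap]
  linear_combination h₂ - h₁

theorem rootGap_pos {c dr vbar : ℝ} (hc : 0 ≤ c) (hx : 0 < dr / (vbar - dr)) :
    0 < rootGap c dr vbar :=
  sub_pos.2 (Real.sqrt_lt_sqrt hc (by linarith))

theorem exists_designConditions {c db dh dr vbar : ℝ} (hc : 0 ≤ c) (hdb : 0 < db) (hdh : 0 < dh)
    (hdr : 0 < dr) (hv : dr < vbar) (hlt : √c + √(c + dr / (vbar - dr)) < 1) :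
    ∃ (φ : ℝ → ℝ) (c0 : ℝ) (αc αcInv : ℝ → ℝ),
      DesignConditions c db dh dr vbar φ c0 αc αcInv := by
  obtain ⟨c0, hc0, hc1⟩ := exists_between hlt
  set D := vbar - dr
  have hDpos : 0 < D := sub_pos.2 hv
  have hx : 0 < dr / D := by positivity
  have hmul := rootGap_mul_add c dr vbar hc hx.le
  have hδ : 0 < rootGap c dr vbar := rootGap_pos hc hx
  set δ := rootGap c dr vbar
  have hc00 : 0 < c0 := lt_of_le_of_lt (by positivity) hc0
  have hgap : dr < c0 * D * δ := by
    have : dr / D < c0 * δ := by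
      rw [← hmul, mul_comm]
      gcongr
    rw [div_lt_iff₀ hDpos] at this
    linarith
  -- The slope `a` makes `alpha_le` an equality; `b` spends half of the slack in `hgap`, leaving
  -- `alpha_gt` strict.
  obtain ⟨a, ha, hadb⟩ : ∃ a : ℝ, 0 < a ∧ c0 * (a * (db / 2)) - dr = c0 * D :=
    ⟨2 * (c0 * D + dr) / (c0 * db), by positivity, by field_simp; ring⟩
  obtain ⟨b, hb, hbdh⟩ : ∃ b : ℝ, 0 < b ∧ c0 * (b * dh) = (c0 * D * δ - dr) / 2 :=
    ⟨(c0 * D * δ - dr) / (2 * c0 * dh), div_pos (by linarith) (by positivity), by field_simp⟩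
  have hneg : ∀ p : ℝ, 0 ≤ p → twoSlope a b (-p) = -(b * p) := fun p hp => by
    rw [twoSlope_of_nonpos a b (by linarith)]; ring
  have ha' : 0 < a⁻¹ := inv_pos.2 ha
  have hb' : 0 < b⁻¹ := inv_pos.2 hb
  set M := a⁻¹ + b⁻¹
  have hMpos : 0 < M := by positivity
  -- The inverse of `αc` is `M`-Lipschitz and its argument exceeds `αc (-p)` by at most `D * (c0 -
  -- s)`, so a ramp of slope above `M * D` satisfies `phi_gt`.
  refine ⟨fun s => (M * D + 1) * max (c0 - s) 0, c0, twoSlope a b, twoSlope a⁻¹ b⁻¹, ?_⟩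
  refine
    { phi_lipschitz := ⟨(M * D + 1).toNNReal, LipschitzWith.lipschitzOnWith ?_⟩
      phi_nonneg := fun s _ => by positivity
      phi_antitone := fun s _ t _ hst => by dsimp only; gcongr
      c0_pos := hc00
      c0_lt_one := hc1
      alpha_class := ⟨(twoSlope_lipschitz ha hb).continuous, twoSlope_strictMono ha hb,
        by simp [twoSlope]⟩
      alpha_lipschitz := ⟨_, twoSlope_lipschitz ha hb⟩
      inv_left := twoSlope_inv_left ha hb
      inv_right := fun s => by simpa using twoSlope_inv_left ha' hb' s
      inv_lipschitz := ⟨_, twoSlope_lipschitz ha' hb'⟩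
      c0_gt := hc0
      alpha_le := ?_
      alpha_gt := ?_
      phi_gt := ?_
      phi_eq_zero := fun s hs => by simp [hs.1] }
  · refine LipschitzWith.of_dist_le_mul fun s t => ?_
    rw [Real.coe_toNNReal _ (by positivity), Real.dist_eq, Real.dist_eq, ← mul_sub, abs_mul,
      abs_of_pos (by positivity)]
    refine mul_le_mul_of_nonneg_left ((abs_max_sub_max_le_abs _ _ _).trans_eq ?_) (by positivity)
    rw [sub_sub_sub_cancel_left, abs_sub_comm]
  · rw [twoSlope_of_nonneg a b (by positivity), hadb]
  · rw [hneg dh hdh.le, twoSlope_of_nonneg a b (by positivity), hadb, div_lt_iff₀ hδ]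
    linarith
  · intro s hs p hp K hK
    have hpb : c0 * (b * p) ≤ c0 * (b * dh) := by gcongr; exact hp.2
    have hs' : 0 < c0 - s := sub_pos.2 hs.2
    have harg : -K * (s - c0) / c0 + (-K * δ + dr) / c0 ≤
        twoSlope a b (-p) + D * (c0 - s) := by
      rw [hneg p hp.1, ← add_div, div_le_iff₀ hc00]
      rcases hK with rfl | hK
      · nlinarith
      · rw [Set.mem_singleton_iff, hneg p hp.1, eq_div_iff hδ.ne'] at hK
        have hKD : K ≤ c0 * D := by
          refine le_of_mul_le_mul_right ?_ hδ
          rw [hK]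
          linarith
        nlinarith
    have hmono := (twoSlope_strictMono ha' hb').monotone harg
    have hlip := abs_twoSlope_sub_le ha' hb' (twoSlope a b (-p) + D * (c0 - s))
      (twoSlope a b (-p))
    rw [twoSlope_inv_left ha hb, add_sub_cancel_left, abs_of_pos (mul_pos hDpos hs')] at hlip
    have hle := (le_abs_self _).trans hlip
    rw [max_eq_left hs'.le]
    calc _ ≤ M * (D * (c0 - s)) := by linarith
      _ < (M * D + 1) * (c0 - s) := by linarith

theorem dsMin_le {N : ℕ} [NeZero N] (ds : Fin N → ℝ) (i : Fin N) : dsMin ds ≤ ds i :=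
  Finset.inf'_le _ (Finset.mem_univ i)

theorem le_dsMax {N : ℕ} [NeZero N] (ds : Fin N → ℝ) (i : Fin N) : ds i ≤ dsMax ds :=
  Finset.le_sup' _ (Finset.mem_univ i)

theorem two_mul_cStar {N : ℕ} [NeZero N] {ds : Fin N → ℝ} {da db : ℝ}
    (h : 0 < dsMax ds + db / 2) :
    2 * cStar ds da db = 1 - (2 * dsMin ds ^ 2 - da ^ 2) / (2 * (dsMax ds + db / 2) ^ 2) := by
  have h2 : 2 * dsMax ds + db = 2 * (dsMax ds + db / 2) := by ring
  rw [cStar, h2]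
  generalize dsMax ds + db / 2 = R at h
  field_simp
  ring

theorem cStar_nonneg {N : ℕ} [NeZero N] {ds : Fin N → ℝ} {da db : ℝ} (hm : 0 < dsMin ds)
    (hdb : 0 < db) : 0 ≤ cStar ds da db := by
  have h := (dsMin_le ds 0).trans (le_dsMax ds 0)
  refine div_nonneg ?_ (by positivity)
  nlinarith [sq_nonneg da]

/-- With `x = dr / (vbar - dr)` the hypothesis reads `√c < (1 - x) / 2`, which is `c + x < (1 - √c)
^ 2`. -/
theorem sqrt_add_sqrt_lt_one {c dr vbar : ℝ} (hc : 0 ≤ c) (hdr : 0 < dr) (hv : 2 * dr < vbar)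
    (h : 2 * c < (vbar - 2 * dr) ^ 2 / (2 * (vbar - dr) ^ 2)) :
    √c + √(c + dr / (vbar - dr)) < 1 := by
  have hD : 0 < vbar - dr := by linarith
  have hx : 0 < dr / (vbar - dr) := by positivity
  have hsq : c < ((1 - dr / (vbar - dr)) / 2) ^ 2 := by
    have : (vbar - 2 * dr) ^ 2 / (2 * (vbar - dr) ^ 2) = 2 * ((1 - dr / (vbar - dr)) / 2) ^ 2 := by
      field_simp
      ring
    linarith
  have hx1 : dr / (vbar - dr) < 1 := by rw [div_lt_one hD]; linarith
  have hr : √c < (1 - dr / (vbar - dr)) / 2 := by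
    rw [Real.sqrt_lt' (by linarith)]
    exact hsq
  have : √(c + dr / (vbar - dr)) < 1 - √c := by
    rw [Real.sqrt_lt' (by linarith)]
    nlinarith [Real.sq_sqrt hc]
  linarith

/-! ### Unit directions -/

section Direction

variable {E : Type*} [NormedAddCommGroup E] [InnerProductSpace ℝ E]

/-- Law of cosines. The condition `d ^ 2 ≤ 2 * r ^ 2` makes the numerator nonnegative, so that `‖a‖
* ‖b‖` may be replaced by `R ^ 2`. -/
theorem norm_sq_normalize_sub_le {a b : E} {r R d : ℝ} (hr : 0 < r) (ha : r ≤ ‖a‖) (hb : r ≤ ‖b‖)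
    (haR : ‖a‖ ≤ R) (hbR : ‖b‖ ≤ R) (hd : ‖a - b‖ ≤ d) (hdr : d ^ 2 ≤ 2 * r ^ 2) :
    ‖‖a‖⁻¹ • a - ‖b‖⁻¹ • b‖ ^ 2 ≤ 2 - (2 * r ^ 2 - d ^ 2) / R ^ 2 := by
  have ha0 : 0 < ‖a‖ := hr.trans_le ha
  have hb0 : 0 < ‖b‖ := hr.trans_le hb
  have hexp : ‖‖a‖⁻¹ • a - ‖b‖⁻¹ • b‖ ^ 2 = 2 - 2 * inner ℝ a b / (‖a‖ * ‖b‖) := by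
    rw [norm_sub_sq_real, real_inner_smul_left, real_inner_smul_right, norm_smul, norm_smul,
      norm_inv, norm_inv, norm_norm, norm_norm, inv_mul_cancel₀ ha0.ne', inv_mul_cancel₀ hb0.ne']
    field_simp
    ring
  have hin : 2 * r ^ 2 - d ^ 2 ≤ 2 * inner ℝ a b := by
    have h := norm_sub_sq_real a b
    have h₁ : r ^ 2 ≤ ‖a‖ ^ 2 := by gcongr
    have h₂ : r ^ 2 ≤ ‖b‖ ^ 2 := by gcongr
    have h₃ : ‖a - b‖ ^ 2 ≤ d ^ 2 := by gcongr
    linarith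
  have hmul : ‖a‖ * ‖b‖ ≤ R ^ 2 := by
    rw [sq]
    gcongr
    exact ha0.le.trans haR
  rw [hexp]
  gcongr
  linarith

theorem norm_normalize_sub_le {a b : E} {r : ℝ} (hr : 0 < r) (ha : r ≤ ‖a‖) (hb : r ≤ ‖b‖) :
    ‖‖a‖⁻¹ • a - ‖b‖⁻¹ • b‖ ≤ 2 / r * ‖a - b‖ := by
  have ha0 : 0 < ‖a‖ := hr.trans_le ha
  have hb0 : 0 < ‖b‖ := hr.trans_le hb
  have h : ‖a‖⁻¹ • a - ‖b‖⁻¹ • b = ‖a‖⁻¹ • (a - b) + (‖a‖⁻¹ * (‖b‖ - ‖a‖)) • ‖b‖⁻¹ • b := by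
    match_scalars <;> field_simp
    ring
  calc ‖‖a‖⁻¹ • a - ‖b‖⁻¹ • b‖ ≤ ‖a‖⁻¹ * ‖a - b‖ + ‖a‖⁻¹ * ‖a - b‖ := by
        rw [h]
        refine (norm_add_le _ _).trans ?_
        rw [norm_smul, norm_smul, norm_smul, norm_mul, norm_inv, norm_inv, norm_norm, norm_norm,
          inv_mul_cancel₀ hb0.ne', mul_one]
        gcongr
        rw [norm_sub_rev a b]
        exact abs_norm_sub_norm_le b a
    _ = 2 * ‖a‖⁻¹ * ‖a - b‖ := by ring
    _ ≤ 2 * r⁻¹ * ‖a - b‖ := by gcongr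
    _ = 2 / r * ‖a - b‖ := by rw [div_eq_mul_inv]

theorem hasFDerivAt_norm_const_sub {a q : E} (h : a ≠ q) :
    HasFDerivAt (fun x => ‖a - x‖) (-innerSL ℝ (‖a - q‖⁻¹ • (a - q))) q := by
  have hne : ‖a - q‖ ≠ 0 := norm_ne_zero_iff.2 (sub_ne_zero.2 h)
  have h₁ : HasFDerivAt (fun x => ‖a - x‖ ^ 2) _ q := ((hasFDerivAt_id q).const_sub a).norm_sq
  have h₂ := h₁.sqrt (pow_ne_zero 2 hne)
  simp only [Real.sqrt_sq (norm_nonneg _)] at h₂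
  refine h₂.congr_fderiv ?_
  ext v
  simp
  field_simp
  ring

end Direction

/-! ### The reshaped QP: bounds, safety and feasibility -/

section Setting

variable {n N : ℕ} {qo : Fin N → Vec n} {ds : Fin N → ℝ}

theorem le_norm_sub_of_barrier [NeZero N] {Δ : ℝ} {q : Vec n} {i : Fin N}
    (h : -Δ ≤ barrier qo ds i q) : dsMin ds - Δ ≤ ‖qo i - q‖ := by
  have := dsMin_le ds i
  rw [barrier] at h
  linarith

theorem norm_obstacleDir {i : Fin N} {q : Vec n} (h : 0 < ‖qo i - q‖) :
    ‖obstacleDir qo i q‖ = 1 := by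
  rw [obstacleDir, norm_smul, norm_inv, norm_norm, inv_mul_cancel₀ h.ne']

theorem abs_regDist_sub_le [NeZero N] {φ : ℝ → ℝ} {q₁ q₂ l : Vec n} {m : ℝ}
    (h : ∀ i, |(‖qo i - q₁‖ - ds i + φ (inner ℝ (obstacleDir qo i q₁) l)) -
      (‖qo i - q₂‖ - ds i + φ (inner ℝ (obstacleDir qo i q₂) l))| ≤ m) :
    |regDist qo ds φ q₁ l - regDist qo ds φ q₂ l| ≤ m := by
  have half : ∀ {f g : Fin N → ℝ}, (∀ i, |f i - g i| ≤ m) →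
      Finset.univ.inf' Finset.univ_nonempty f - Finset.univ.inf' Finset.univ_nonempty g ≤ m := by
    intro f g hfg
    obtain ⟨i, -, hi⟩ := Finset.exists_mem_eq_inf' (Finset.univ_nonempty (α := Fin N)) g
    rw [hi]
    have h₁ : Finset.univ.inf' Finset.univ_nonempty f ≤ f i := Finset.inf'_le _ (Finset.mem_univ i)
    have h₂ := le_abs_self (f i - g i)
    linarith [hfg i]
  rw [abs_le]
  refine ⟨?_, half h⟩
  have := half (f := fun i => ‖qo i - q₂‖ - ds i + φ (inner ℝ (obstacleDir qo i q₂) l))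
    (g := fun i => ‖qo i - q₁‖ - ds i + φ (inner ℝ (obstacleDir qo i q₁) l))
    fun i => by rw [abs_sub_comm]; exact h i
  simp only [regDist]
  linarith

theorem inner_mem_Icc {u l : Vec n} (hu : ‖u‖ = 1) (hl : ‖l‖ = 1) :
    inner ℝ u l ∈ Set.Icc (-1 : ℝ) 1 := by
  have := abs_real_inner_le_norm u l
  rw [hu, hl, one_mul] at this
  exact abs_le.1 this

/-- The right-hand sides of the constraints of the reshaped QP. -/
noncomputable def constraintBound [NeZero N] (qo : Fin N → Vec n) (ds : Fin N → ℝ) (dr vbar : ℝ) (φ : ℝ → ℝ)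
    (c0 : ℝ) (αc : ℝ → ℝ) (q l : Vec n) : ℝ :=
  min (c0 * αc (regDist qo ds φ q l) - dr) (c0 * (vbar - dr))

theorem feasibleSet_eq_polyhedron [NeZero N] (dr vbar : ℝ) (φ : ℝ → ℝ) (c0 : ℝ) (αc : ℝ → ℝ)
    (L : Finset (Vec n)) (q : Vec n) :
    feasibleSet qo ds dr vbar φ c0 αc L q =
      polyhedron L (constraintBound qo ds dr vbar φ c0 αc q) := by
  ext v
  simp [feasibleSet, polyhedron, constraintBound]

theorem isQPSolution_iff [NeZero N] {dr vbar : ℝ} {φ : ℝ → ℝ} {c0 : ℝ} {αc : ℝ → ℝ}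
    {L : Finset (Vec n)} {q vc v : Vec n} :
    IsQPSolution qo ds dr vbar φ c0 αc L q vc v ↔
      IsProjection L (constraintBound qo ds dr vbar φ c0 αc q) vc v := by
  rw [isProjection_iff, IsQPSolution, feasibleSet_eq_polyhedron]

/-- The constraint bounds are Lipschitz in the position. -/
theorem DesignConditions.exists_abs_constraintBound_sub_le [NeZero N] {c db dh dr vbar : ℝ}
    {φ : ℝ → ℝ} {c0 : ℝ} {αc αcInv : ℝ → ℝ}
    (hD : DesignConditions c db dh dr vbar φ c0 αc αcInv) {Δ : ℝ} (hΔ : Δ < dsMin ds) :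
    ∃ C : ℝ, 0 ≤ C ∧ ∀ q₁ q₂ l : Vec n, ‖l‖ = 1 → (∀ i, -Δ ≤ barrier qo ds i q₁) →
      (∀ i, -Δ ≤ barrier qo ds i q₂) →
      |constraintBound qo ds dr vbar φ c0 αc q₁ l - constraintBound qo ds dr vbar φ c0 αc q₂ l| ≤
        C * ‖q₁ - q₂‖ := by
  obtain ⟨Kφ, hφ⟩ := hD.phi_lipschitz
  obtain ⟨Kα, hα⟩ := hD.alpha_lipschitz
  have hr : 0 < dsMin ds - Δ := sub_pos.2 hΔ
  have hc0 := hD.c0_pos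
  refine ⟨c0 * (Kα * (1 + Kφ * (2 / (dsMin ds - Δ)))), by positivity,
    fun q₁ q₂ l hl h₁ h₂ => ?_⟩
  have hreg : |regDist qo ds φ q₁ l - regDist qo ds φ q₂ l| ≤
      (1 + Kφ * (2 / (dsMin ds - Δ))) * ‖q₁ - q₂‖ := by
    refine abs_regDist_sub_le fun i => ?_
    have hi₁ := le_norm_sub_of_barrier (h₁ i)
    have hi₂ := le_norm_sub_of_barrier (h₂ i)
    have hsub : ‖(qo i - q₁) - (qo i - q₂)‖ = ‖q₁ - q₂‖ := by
      rw [sub_sub_sub_cancel_left, norm_sub_rev]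
    have hdir : |inner ℝ (obstacleDir qo i q₁) l - inner ℝ (obstacleDir qo i q₂) l| ≤
        2 / (dsMin ds - Δ) * ‖q₁ - q₂‖ := by
      rw [← inner_sub_left, ← hsub]
      refine (abs_real_inner_le_norm _ _).trans ?_
      rw [hl, mul_one]
      exact norm_normalize_sub_le hr hi₁ hi₂
    have hφ' := hφ.dist_le_mul _ (inner_mem_Icc (norm_obstacleDir (hr.trans_le hi₁)) hl) _
      (inner_mem_Icc (norm_obstacleDir (hr.trans_le hi₂)) hl)
    rw [Real.dist_eq, Real.dist_eq] at hφ'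
    have hn := abs_norm_sub_norm_le (qo i - q₁) (qo i - q₂)
    rw [hsub] at hn
    calc _ = |(‖qo i - q₁‖ - ‖qo i - q₂‖) + (φ (inner ℝ (obstacleDir qo i q₁) l) -
            φ (inner ℝ (obstacleDir qo i q₂) l))| := by congr 1; ring
      _ ≤ ‖q₁ - q₂‖ + Kφ * (2 / (dsMin ds - Δ) * ‖q₁ - q₂‖) := by
          refine (abs_add_le _ _).trans (add_le_add hn (hφ'.trans ?_))
          gcongr
      _ = _ := by ring
  have hα' := hα.dist_le_mul (regDist qo ds φ q₁ l) (regDist qo ds φ q₂ l)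
  rw [Real.dist_eq, Real.dist_eq] at hα'
  refine (abs_min_sub_min_le_max _ _ _ _).trans ?_
  rw [sub_self, abs_zero, max_eq_left (abs_nonneg _), sub_sub_sub_cancel_right, ← mul_sub, abs_mul,
    abs_of_pos hc0, mul_assoc, mul_assoc]
  gcongr
  refine hα'.trans ?_
  gcongr

/-- A unit vector whose cap constraints are bounded by `M` has a bounded component of `v`. -/
theorem IsPositiveBasis.exists_inner_le {c0 : ℝ} {L : Finset (Vec n)} (hL : IsPositiveBasis c0 L)
    {u v : Vec n} (hu : ‖u‖ = 1) {M : ℝ}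
    (hM : ∀ l ∈ L, c0 ≤ inner ℝ l u → inner ℝ l v ≤ M) :
    ∃ σ : ℝ, 1 ≤ σ ∧ c0 * σ ≤ 1 ∧ inner ℝ u v ≤ σ * M := by
  obtain ⟨ρ, hρ, hcomb⟩ := hL.combination u hu
  set F := L.filter fun l => c0 ≤ inner ℝ l u
  have hmem : ∀ l ∈ F, l ∈ L ∧ c0 ≤ inner ℝ l u := fun l hl => Finset.mem_filter.1 hl
  have hinner : ∀ w, inner ℝ u w = ∑ l ∈ F, ρ l * inner ℝ l w := fun w => by
    conv_lhs => rw [hcomb]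
    simp only [sum_inner, real_inner_smul_left]
  -- The triangle inequality bounds the sum of the weights below, and pairing with `u` bounds it
  -- above.
  refine ⟨∑ l ∈ F, ρ l, ?_, ?_, ?_⟩
  · calc (1 : ℝ) = ‖u‖ := hu.symm
      _ ≤ ∑ l ∈ F, ‖ρ l • l‖ := by
          conv_lhs => rw [hcomb]
          exact norm_sum_le _ _
      _ = ∑ l ∈ F, ρ l := by
          refine Finset.sum_congr rfl fun l hl => ?_
          rw [norm_smul, hL.norm_eq_one l (hmem l hl).1, mul_one, Real.norm_of_nonneg (hρ l)]
  · have h1 : inner ℝ u u = (1 : ℝ) := by rw [real_inner_self_eq_norm_sq, hu, one_pow]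
    rw [← h1, hinner, Finset.mul_sum]
    refine Finset.sum_le_sum fun l hl => ?_
    rw [mul_comm]
    exact mul_le_mul_of_nonneg_left (hmem l hl).2 (hρ l)
  · rw [hinner, Finset.sum_mul]
    exact Finset.sum_le_sum fun l hl =>
      mul_le_mul_of_nonneg_left (hM l (hmem l hl).1 (hmem l hl).2) (hρ l)

theorem regDist_le_barrier [NeZero N] {φ : ℝ → ℝ} {q l : Vec n} {i : Fin N}
    (h : φ (inner ℝ (obstacleDir qo i q) l) = 0) : regDist qo ds φ q l ≤ barrier qo ds i q := by
  refine (Finset.inf'_le _ (Finset.mem_univ i)).trans_eq ?_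
  rw [h, add_zero, barrier]

/-- Feasible velocities keep the distance to the obstacles. -/
theorem DesignConditions.inner_obstacleDir_le [NeZero N] {c db dh dr vbar : ℝ}
    {φ : ℝ → ℝ} {c0 : ℝ} {αc αcInv : ℝ → ℝ}
    (hD : DesignConditions c db dh dr vbar φ c0 αc αcInv) (hdr : 0 < dr) {L : Finset (Vec n)}
    (hL : IsPositiveBasis c0 L) {q v : Vec n} {i : Fin N} (hq : 0 < ‖qo i - q‖)
    (hv : v ∈ feasibleSet qo ds dr vbar φ c0 αc L q) :
    inner ℝ (obstacleDir qo i q) v ≤ alphaP c0 αc (barrier qo ds i q) - dr := by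
  have hu := norm_obstacleDir hq
  have hc0 := hD.c0_pos
  obtain ⟨σ, h1σ, hσ, hle⟩ := hL.exists_inner_le hu (v := v)
    (M := c0 * αc (barrier qo ds i q) - dr) fun l hl hcap => by
      refine (hv l hl).1.trans ?_
      rw [real_inner_comm] at hcap
      have h0 := hD.phi_eq_zero _ ⟨hcap, (inner_mem_Icc hu (hL.norm_eq_one l hl)).2⟩
      have := hD.alpha_class.strictMono.monotone (regDist_le_barrier (ds := ds) h0)
      gcongr
  refine hle.trans ?_
  rw [alphaP]
  -- For a nonnegative bound `c0 * σ ≤ 1` is the useful estimate, for a nonpositive one `1 ≤ σ`; the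
  -- two outcomes are the two branches of `alphaP`.
  rcases le_total 0 (c0 * αc (barrier qo ds i q) - dr) with h | h
  · have hα : 0 ≤ αc (barrier qo ds i q) := by
      by_contra! hneg
      linarith [mul_neg_of_pos_of_neg hc0 hneg]
    have h1 := le_max_left (αc (barrier qo ds i q)) (c0 * αc (barrier qo ds i q))
    have h2 := mul_le_mul_of_nonneg_right hσ hα
    have h3 := mul_le_mul_of_nonneg_right h1σ hdr.le
    linarith
  · have h1 := le_max_right (αc (barrier qo ds i q)) (c0 * αc (barrier qo ds i q))
    have h2 := mul_le_mul_of_nonpos_right h1σ h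
    linarith

theorem norm_le_of_mem_feasibleSet [NeZero N] {dr vbar : ℝ} {φ : ℝ → ℝ} {c0 : ℝ} {αc : ℝ → ℝ}
    (hv : dr < vbar) {L : Finset (Vec n)} (hL : IsPositiveBasis c0 L) {q v : Vec n}
    (hvf : v ∈ feasibleSet qo ds dr vbar φ c0 αc L q) : ‖v‖ ≤ vbar - dr := by
  rcases (norm_nonneg v).eq_or_lt with h | h
  · rw [← h]; linarith
  have hu : ‖‖v‖⁻¹ • v‖ = 1 := by rw [norm_smul, norm_inv, norm_norm, inv_mul_cancel₀ h.ne']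
  obtain ⟨σ, -, hσ, hle⟩ := hL.exists_inner_le hu (v := v) (M := c0 * (vbar - dr))
    fun l hl _ => (hvf l hl).2
  rw [real_inner_smul_left, real_inner_self_eq_norm_mul_norm, inv_mul_cancel_left₀ h.ne'] at hle
  have := mul_le_mul_of_nonneg_right hσ (sub_nonneg.2 hv.le)
  linarith

/-- Directions to obstacles close to `q` are close to each other. -/
theorem ObstacleDistance.norm_sq_obstacleDir_sub_le [NeZero N] {da db dh : ℝ}
    (hobs : ObstacleDistance qo ds da db dh) {Δ : ℝ} (hΔ : Δ ≤ dh)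
    (hda : da ^ 2 ≤ 2 * (dsMin ds - Δ) ^ 2) {q : Vec n} (hq : ∀ i, -Δ ≤ barrier qo ds i q)
    {j k : Fin N} (hj : barrier qo ds j q ≤ db / 2) (hk : barrier qo ds k q ≤ db / 2) :
    ‖obstacleDir qo j q - obstacleDir qo k q‖ ^ 2 ≤
      2 - (2 * (dsMin ds - Δ) ^ 2 - da ^ 2) / (dsMax ds + db / 2) ^ 2 := by
  have hup : ∀ i, barrier qo ds i q ≤ db / 2 → ‖qo i - q‖ ≤ dsMax ds + db / 2 := fun i hi => by
    have := le_dsMax ds i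
    rw [barrier] at hi
    linarith
  refine norm_sq_normalize_sub_le (by linarith [hobs.dh_lt]) (le_norm_sub_of_barrier (hq j))
    (le_norm_sub_of_barrier (hq k)) (hup j hj) (hup k hk) ?_ hda
  rw [sub_sub_sub_cancel_right]
  exact hobs.dist_le q (fun i => by linarith [hq i]) j k hj hk

/-- Far obstacles tolerate any speed up to `K`, by `alpha_gt`. Near ones have almost the same
direction, so retreating from one of them with speed `K` works for all. -/
theorem DesignConditions.feasibleSet_nonempty [NeZero N] {c db dh dr vbar : ℝ}
    {φ : ℝ → ℝ} {c0 : ℝ} {αc αcInv : ℝ → ℝ}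
    (hD : DesignConditions c db dh dr vbar φ c0 αc αcInv) (hδ : 0 < rootGap c dr vbar)
    (hdr : 0 < dr) {Δ : ℝ} (hΔ0 : 0 ≤ Δ) (hΔ : Δ ≤ dh) (hΔm : Δ < dsMin ds) {q : Vec n}
    (hq : ∀ i, -Δ ≤ barrier qo ds i q)
    (hdir : ∀ j k, barrier qo ds j q ≤ db / 2 → barrier qo ds k q ≤ db / 2 →
      ‖obstacleDir qo j q - obstacleDir qo k q‖ ≤ c0 - rootGap c dr vbar)
    {L : Finset (Vec n)} (hL : ∀ l ∈ L, ‖l‖ = 1) :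
    (feasibleSet qo ds dr vbar φ c0 αc L q).Nonempty := by
  set δ := rootGap c dr vbar with hδdef
  have hc0 := hD.c0_pos
  have hmono := hD.alpha_class.strictMono.monotone
  have hu : ∀ i, ‖obstacleDir qo i q‖ = 1 := fun i =>
    norm_obstacleDir ((sub_pos.2 hΔm).trans_le (le_norm_sub_of_barrier (hq i)))
  set K := (dr - c0 * αc (-Δ)) / δ with hK
  have hKδ : K * δ = dr - c0 * αc (-Δ) := div_mul_cancel₀ _ hδ.ne'
  have hα0 : αc (-Δ) ≤ 0 := by
    rw [← hD.alpha_class.map_zero]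
    exact hmono (by linarith)
  have hKpos : 0 < K :=
    div_pos (by linarith [mul_nonpos_of_nonneg_of_nonpos hc0.le hα0]) hδ
  have hKlt : K < c0 * αc (db / 2) - dr := by
    refine lt_of_le_of_lt ?_ hD.alpha_gt
    have := hmono (neg_le_neg hΔ)
    rw [hK]
    gcongr
  have hsplit : ∀ l ∈ L, ∀ x : ℝ, (∀ i, x ≤ c0 * αc (barrier qo ds i q +
      φ (inner ℝ (obstacleDir qo i q) l)) - dr) → x ≤ c0 * αc (regDist qo ds φ q l) - dr := by
    intro l _ x hx
    obtain ⟨i, -, hi⟩ := Finset.exists_mem_eq_inf' (Finset.univ_nonempty (α := Fin N))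
      fun i : Fin N => ‖qo i - q‖ - ds i + φ (inner ℝ (obstacleDir qo i q) l)
    rw [regDist, hi]
    exact hx i
  have hfar : ∀ l ∈ L, ∀ i, db / 2 < barrier qo ds i q →
      K ≤ c0 * αc (barrier qo ds i q + φ (inner ℝ (obstacleDir qo i q) l)) - dr := by
    intro l hl i hi
    have h0 := hD.phi_nonneg _ (inner_mem_Icc (hu i) (hL l hl))
    have := hmono (show db / 2 ≤ barrier qo ds i q + φ (inner ℝ (obstacleDir qo i q) l) by linarith)
    have := mul_le_mul_of_nonneg_left this hc0.le
    linarith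
  by_cases hnear : ∃ k, barrier qo ds k q ≤ db / 2
  · obtain ⟨k, hk⟩ := hnear
    refine ⟨-(K • obstacleDir qo k q), fun l hl => ?_⟩
    have hval : inner ℝ l (-(K • obstacleDir qo k q)) = -K * inner ℝ (obstacleDir qo k q) l := by
      rw [inner_neg_right, real_inner_smul_right, real_inner_comm, neg_mul]
    have hle : -K * inner ℝ (obstacleDir qo k q) l ≤ K := by
      have := (inner_mem_Icc (hu k) (hL l hl)).1
      nlinarith
    rw [hval]
    refine ⟨hsplit l hl _ fun i => ?_, by linarith [hD.alpha_le]⟩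
    rcases lt_or_ge (db / 2) (barrier qo ds i q) with hi | hi
    · exact hle.trans (hfar l hl i hi)
    have hs := inner_mem_Icc (hu i) (hL l hl)
    have hclose : inner ℝ (obstacleDir qo i q) l - (c0 - δ) ≤ inner ℝ (obstacleDir qo k q) l := by
      have h1 := real_inner_le_norm (obstacleDir qo i q - obstacleDir qo k q) l
      rw [hL l hl, mul_one, inner_sub_left] at h1
      linarith [hdir i k hi hk]
    have hstep : -K * inner ℝ (obstacleDir qo k q) l ≤
        -K * (inner ℝ (obstacleDir qo i q) l - c0) + -K * δ := by
      nlinarith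
    generalize inner ℝ (obstacleDir qo i q) l = s at *
    refine hstep.trans ?_
    rcases lt_or_ge s c0 with hsc | hsc
    -- Taking `p = Δ` covers the worst admissible violation, and `K` is then the second of the two
    -- listed values.
    · have hφ := hD.phi_gt s ⟨hs.1, hsc⟩ Δ ⟨hΔ0, hΔ⟩ K (by simp [hK, hδdef])
      have := hmono (show αcInv (-K * (s - c0) / c0 + (-K * δ + dr) / c0) ≤
        barrier qo ds i q + φ s by linarith [hq i])
      rw [hD.inv_right, ← add_div, div_le_iff₀ hc0] at this
      linarith
    -- On the cap, `K * δ = dr - c0 * αc (-Δ)` is exactly the required retreat.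
    · rw [hD.phi_eq_zero s ⟨hsc, hs.2⟩, add_zero]
      have := mul_le_mul_of_nonneg_left (hmono (hq i)) hc0.le
      have := mul_nonneg hKpos.le (sub_nonneg.2 hsc)
      linarith
  · push Not at hnear
    refine ⟨0, fun l hl => ?_⟩
    rw [inner_zero_right]
    exact ⟨hsplit l hl _ fun i => hKpos.le.trans (hfar l hl i (hnear i)),
      by linarith [hD.alpha_le]⟩

end Setting

end ReshapedQP

/-! ### The main theorem -/

theorem proposition1 {n N : ℕ} [NeZero N]
    (qo : Fin N → ReshapedQP.Vec n) (ds : Fin N → ℝ) (hds : ∀ i, 0 < ds i)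
    (da db dh dr vbar : ℝ) (hdr : 0 < dr)
    (hobs : ReshapedQP.ObstacleDistance qo ds da db dh)
    (ha1 : √2 * ReshapedQP.dsMin ds > da)
    (ha2 : vbar > 2 * dr)
    (ha3 : (2 * ReshapedQP.dsMin ds ^ 2 - da ^ 2) / (2 * (ReshapedQP.dsMax ds + db / 2) ^ 2) >
      1 - (vbar - 2 * dr) ^ 2 / (2 * (vbar - dr) ^ 2)) :
    -- suitable design data exist
    (∃ (φ : ℝ → ℝ) (c0 : ℝ) (αc αcInv : ℝ → ℝ),
      ReshapedQP.DesignConditions (ReshapedQP.cStar ds da db) db dh dr vbar φ c0 αc αcInv) ∧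
    -- and all such design data make the reshaped QP well posed
    ∀ (φ : ℝ → ℝ) (c0 : ℝ) (αc αcInv : ℝ → ℝ),
      ReshapedQP.DesignConditions (ReshapedQP.cStar ds da db) db dh dr vbar φ c0 αc αcInv →
      (∃ L : Finset (ReshapedQP.Vec n), ReshapedQP.IsPositiveBasis c0 L) ∧
      ∃ Δh : ℝ, 0 < Δh ∧ Δh ≤ dh ∧
        ∀ L : Finset (ReshapedQP.Vec n), ReshapedQP.IsPositiveBasis c0 L →
          -- (a)
          (∀ q : ReshapedQP.Vec n, (∀ i, ReshapedQP.barrier qo ds i q ≥ -Δh) →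
            ∀ vc : ReshapedQP.Vec n,
              ∃! v, ReshapedQP.IsQPSolution qo ds dr vbar φ c0 αc L q vc v) ∧
          -- (b)
          (∀ q : ReshapedQP.Vec n, (∀ i, ReshapedQP.barrier qo ds i q ≥ -Δh) →
            ∀ vc v : ReshapedQP.Vec n,
              ReshapedQP.IsQPSolution qo ds dr vbar φ c0 αc L q vc v →
              (∀ qdot vtilde : ReshapedQP.Vec n, qdot = v + vtilde →
                ∀ i, DifferentiableAt ℝ (ReshapedQP.barrier qo ds i) q ∧
                  fderiv ℝ (ReshapedQP.barrier qo ds i) q qdot ≥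
                    -ReshapedQP.alphaP c0 αc (ReshapedQP.barrier qo ds i q) + dr - ‖vtilde‖) ∧
              ‖v‖ ≤ vbar - dr) ∧
          -- (c)
          (∀ varphi : ReshapedQP.Vec n → ReshapedQP.Vec n → ReshapedQP.Vec n,
            (∀ q : ReshapedQP.Vec n, (∀ i, ReshapedQP.barrier qo ds i q ≥ -Δh) →
              ∀ vc, ReshapedQP.IsQPSolution qo ds dr vbar φ c0 αc L q vc (varphi q vc)) →
            ∃ K : ℝ, 0 < K ∧ ∀ q₁ q₂ : ReshapedQP.Vec n,
              (∀ i, ReshapedQP.barrier qo ds i q₁ ≥ -Δh) →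
              (∀ i, ReshapedQP.barrier qo ds i q₂ ≥ -Δh) →
              ∀ vc₁ vc₂ : ReshapedQP.Vec n,
                ‖varphi q₁ vc₁ - varphi q₂ vc₂‖ ≤ K * (‖q₁ - q₂‖ + ‖vc₁ - vc₂‖)) := by
  open ReshapedQP in
  have hm : 0 < dsMin ds := hobs.da_pos.trans hobs.da_lt
  have hR : 0 < dsMax ds + db / 2 := by
    have := (hds 0).trans_le (le_dsMax ds 0)
    linarith [hobs.db_pos]
  have hc : 0 ≤ cStar ds da db := cStar_nonneg hm hobs.db_pos
  have h2c := two_mul_cStar (da := da) hR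
  have hv : dr < vbar := by linarith
  have hx : 0 < dr / (vbar - dr) := div_pos hdr (by linarith)
  refine ⟨exists_designConditions hc hobs.db_pos hobs.dh_pos hdr hv
    (sqrt_add_sqrt_lt_one hc hdr ha2 (by linarith)), fun φ c0 αc αcInv hD =>
    ⟨exists_isPositiveBasis n hD.c0_pos hD.c0_lt_one, ?_⟩⟩
  have hδ := rootGap_pos hc hx
  have hgap : 2 * √(cStar ds da db) < c0 - rootGap (cStar ds da db) dr vbar := by
    have := hD.c0_gt
    rw [rootGap]
    linarith
  have hgap0 : 0 < c0 - rootGap (cStar ds da db) dr vbar := lt_of_le_of_lt (by positivity) hgap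
  -- Both conditions hold strictly at `Δ = 0`, the second because its left side is then `4 * cStar`;
  -- continuity leaves room for a positive `Δ`.
  obtain ⟨Δ, hΔ0, hΔ, hΔda, hΔdir⟩ : ∃ Δ : ℝ, 0 < Δ ∧ Δ ≤ dh ∧
      da ^ 2 ≤ 2 * (dsMin ds - Δ) ^ 2 ∧
      2 - (2 * (dsMin ds - Δ) ^ 2 - da ^ 2) / (dsMax ds + db / 2) ^ 2 ≤
        (c0 - rootGap (cStar ds da db) dr vbar) ^ 2 := by
    have hcont₁ : Continuous fun Δ : ℝ => 2 * (dsMin ds - Δ) ^ 2 := by fun_prop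
    have hcont₂ : Continuous fun Δ : ℝ =>
        2 - (2 * (dsMin ds - Δ) ^ 2 - da ^ 2) / (dsMax ds + db / 2) ^ 2 := by fun_prop
    have hev₁ := (hcont₁.tendsto 0).eventually_const_lt (u := da ^ 2) (by
      nlinarith [hobs.da_pos, hobs.da_lt])
    have hev₂ := (hcont₂.tendsto 0).eventually_lt_const
      (u := (c0 - rootGap (cStar ds da db) dr vbar) ^ 2) (by
      have h4 : 2 - (2 * (dsMin ds - 0) ^ 2 - da ^ 2) / (dsMax ds + db / 2) ^ 2 =
          (2 * √(cStar ds da db)) ^ 2 := by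
        rw [mul_pow, Real.sq_sqrt hc, show (2 : ℝ) ^ 2 * cStar ds da db = 2 * (2 * cStar ds da db)
          by ring, h2c, sub_zero]
        field_simp
      rw [h4]
      gcongr)
    have hev₃ : ∀ᶠ Δ in nhdsWithin (0 : ℝ) (Set.Ioi 0), Δ ∈ Set.Ioc 0 dh :=
      Ioc_mem_nhdsGT hobs.dh_pos
    obtain ⟨Δ, ⟨h₁, h₂⟩, h₃⟩ :=
      (((hev₁.and hev₂).filter_mono nhdsWithin_le_nhds).and hev₃).exists
    exact ⟨Δ, h₃.1, h₃.2, h₁.le, h₂.le⟩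
  have hΔm : Δ < dsMin ds := hΔ.trans_lt hobs.dh_lt
  refine ⟨Δ, hΔ0, hΔ, fun L hL => ⟨fun q hq vc => ?_, fun q hq vc v hsol => ⟨?_, ?_⟩, ?_⟩⟩
  · have hne := hD.feasibleSet_nonempty hδ hdr hΔ0.le hΔ hΔm hq (fun j k hj hk =>
      le_of_sq_le_sq ((hobs.norm_sq_obstacleDir_sub_le hΔ hΔda hq hj hk).trans hΔdir) hgap0.le)
      hL.norm_eq_one
    rw [feasibleSet_eq_polyhedron] at hne
    obtain ⟨v, hv⟩ := exists_isProjection hne vc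
    refine ⟨v, isQPSolution_iff.2 hv, fun w hw => ?_⟩
    have := (isQPSolution_iff.1 hw).norm_sub_le hv
    rw [sub_self, norm_zero] at this
    exact sub_eq_zero.1 (norm_le_zero_iff.1 this)
  · rintro _ vtilde rfl i
    have hpos : 0 < ‖qo i - q‖ := (sub_pos.2 hΔm).trans_le (le_norm_sub_of_barrier (hq i))
    have hder : HasFDerivAt (barrier qo ds i) _ q :=
      (hasFDerivAt_norm_const_sub (sub_ne_zero.1 (norm_pos_iff.1 hpos))).sub_const (ds i)
    refine ⟨hder.differentiableAt, ?_⟩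
    have hval : fderiv ℝ (barrier qo ds i) q (v + vtilde) =
        -(inner ℝ (obstacleDir qo i q) v + inner ℝ (obstacleDir qo i q) vtilde) := by
      rw [hder.fderiv, ← inner_add_right]
      rfl
    have h₁ := hD.inner_obstacleDir_le hdr hL hpos hsol.1
    have h₂ := real_inner_le_norm (obstacleDir qo i q) vtilde
    rw [norm_obstacleDir hpos, one_mul] at h₂
    rw [hval]
    linarith
  · exact norm_le_of_mem_feasibleSet hv hL hsol.1
  · intro varphi hvarphi
    obtain ⟨C, hC0, hC⟩ := exists_norm_sub_le_of_isProjection L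
    obtain ⟨B, hB0, hB⟩ := hD.exists_abs_constraintBound_sub_le (qo := qo) hΔm
    -- Compare through `varphi q₂ vc₁`: moving `q` costs `C * B`, moving `vc` costs 1.
    refine ⟨C * B + 1, by positivity, fun q₁ q₂ hq₁ hq₂ vc₁ vc₂ => ?_⟩
    have hsol : ∀ q, (∀ i, barrier qo ds i q ≥ -Δ) → ∀ vc, _ := fun q hq vc =>
      isQPSolution_iff.1 (hvarphi q hq vc)
    have h₁ := hC _ _ vc₁ _ _ (B * ‖q₁ - q₂‖) (by positivity)
      (fun l hl => hB q₁ q₂ l (hL.norm_eq_one l hl) hq₁ hq₂) (hsol q₁ hq₁ vc₁) (hsol q₂ hq₂ vc₁)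
    have h₂ := (hsol q₂ hq₂ vc₁).norm_sub_le (hsol q₂ hq₂ vc₂)
    have h₃ := norm_sub_le_norm_sub_add_norm_sub (varphi q₁ vc₁) (varphi q₂ vc₁) (varphi q₂ vc₂)
    have h₄ : 0 ≤ C * B * ‖vc₁ - vc₂‖ := by positivity
    have h₅ := norm_nonneg (q₁ - q₂)
    linarith
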